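/- **Proposition 2.1.** *Notation.* For a finite Borel measure $\mu$ on $\mathbb R$ and $k\ge 0$ let $\pi_k(\cdot;\mu)$ be the monic orthogonal polynomial of degree $k$, and put $$c_k(z;\mu)=\frac1{2\pi i}\int_{\mathbb R}\frac{\pi_k(\lambda;\mu)}{\lambda-z}\,\mu(d\lambda),\qquad \gamma_k(\mu)=-2\pi i\,\|\pi_k(\cdot;\mu)\|_{L^2(\mu)}^{-2}.$$ For $n\ge1$ and $z\notin\mathrm{supp}(\mu)$ let $$Y_n(z;\mu)=\begin{bmatrix}\pi_n(z;\mu)&c_n(z;\mu)\\ \gamma_{n-1}(\mu)\pi_{n-1}(z;\mu)&\gamma_{n-1}(\mu)c_{n-1}(z;\mu)\end{bmatrix}.$$ Given a simple closed contour $\Gamma$, oriented counter-clockwise and encircling $\mathrm{supp}(\mu)$, let $\tilde Y_n(z;\mu)=Y_n(z;\mu)\begin{bmatrix}1&-c_0(z;\mu)\\0&1\end{bmatrix}$ for $z$ inside $\Gamma$ and $\tilde Y_n(z;\mu)=Y_n(z;\mu)$ otherwise. For fixed $\mathfrak c\in\mathbb C\setminus\{0\}$ and an integer $p\ge 0$ let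 $\check Y_n(z;\mu)=\mathrm{diag}(\mathfrak c^{\,n-p},\mathfrak c^{\,-(n-p)})\,\tilde Y_n(z;\mu)$, with boundary value $\check Y_n^-$ on $\Gamma$ from the exterior. For two measures $\mu,\nu$ (with the same $\mathfrak c$, $p$) and $\Gamma$ encircling both supports put $c_0(z;\mu-\nu)=c_0(z;\mu)-c_0(z;\nu)$ and $$X_n(z;\mu,\nu)=\check Y_n(z;\nu)\,\check Y_n(z;\mu)^{-1},\qquad M_n(z;\mu)=\check Y_n^-(z;\mu)\begin{bmatrix}0&1\\0&0\end{bmatrix}\check Y_n^-(z;\mu)^{-1},$$ $$J_n(z)=I+c_0(z;\mu-\nu)\,M_n(z;\mu)\quad(z\in\Gamma).$$ For a function $U$ on $\Gamma$ let $\mathcal C_\Gamma U(z)=\frac1{2\pi i}\int_\Gamma\frac{U(z')}{z'-z}\,dz'$, and let $\mathcal C_\Gamma^-U$ be its almost everywhere defined non-tangential boundary value on $\Gamma$ from the exterior. Matrices carry the norm $\|A\|=\max_{i,j}|A_{ij}|$. *Statement.* For $N=0,1,2,\dots$ let $\mu=\mu(N)$ and $\nu=\nu(N)$ be finite Borel measures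 on $\mathbb R$ (where $\mu(N)$ may be constant in $N$), $n=n(N)\ge1$ an integer such that $\mathrm{supp}(\mu)$ and $\mathrm{supp}(\nu)$ have at least $n$ points each, $\mathfrak c=\mathfrak c(N)\neq0$ and $p=p(N)\in\mathbb Z_{\ge 0}$; let $\Gamma=\Gamma(N)$ be a piecewise smooth, simple, closed, counter-clockwise oriented curve that encircles $\mathrm{supp}(\mu)\cup\mathrm{supp}(\nu)$, such that the operator norm of $\mathcal C^-_\Gamma$ on $L^2(\Gamma)$ (with respect to arc length) is at most $C_N<\infty$. Assume that the lengths of the curves $\Gamma(N)$ are bounded uniformly in $N$ and that all the sets $\mathrm{supp}(\mu(N))$ lie in a common bounded interval. If $$C_N\,\|J_n-I\|_{L^\infty(\Gamma)}\longrightarrow0\qquad(N\to\infty),$$ then $X_n(\cdot;\mu,\nu)$ extends analytically across $\mathrm{supp}(\mu)\cup\mathrm{supp}(\nu)$ to $\mathbb C\setminus\Gamma$, and $$X_n(z;\mu,\nu)=I+\frac1{2\pi i}\int_\Gamma\frac{c_0(z';\mu-\nu)\,M_n(z';\mu)}{z'-z}\,dz'+O\!\left(C_N\frac{\|J_n-I\|_{L^\infty(\Gamma)}^2}{1+|z|}\right)$$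 uniformly on subsets of $\mathbb C$ bounded uniformly away from $\Gamma$: for every $\delta>0$ there is a constant $K$ such that for all sufficiently large $N$ and all $z\in\mathbb C$ with $\mathrm{dist}(z,\Gamma(N))\ge\delta$ the norm of the error term is at most $K\,C_N\|J_n-I\|_{L^\infty(\Gamma)}^2/(1+|z|)$. -/

import Mathlib

open MeasureTheory Filter Topology Polynomial

-- Matrices carry the norm `‖A‖ = max |A i j|`.
attribute [local instance] Matrix.normedAddCommGroup

noncomputable section

namespace RHPerturb

/-! ### Contours -/

/-- The Cauchy integral `(2πi)⁻¹ ∫_γ f(w) / (w - z) dw` over the curve `γ`, parametrised by `[0,1]`. -/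
def cauchyAlong (γ : ℝ → ℂ) (f : ℂ → ℂ) (z : ℂ) : ℂ :=
  (2 * Real.pi * Complex.I)⁻¹ * ∫ t in (0 : ℝ)..1, f (γ t) / (γ t - z) * deriv γ t

/-- The winding number of `γ` about `z` (meaningful for `z` off the curve). -/
def windingNumber (γ : ℝ → ℂ) (z : ℂ) : ℂ := cauchyAlong γ (fun _ => 1) z

/-- `γ` is piecewise smooth on `[0,1]`: there is a finite partition such that, on each closed piece,
`γ` is `C¹` with nowhere vanishing derivative (one-sided at the end points of the piece). -/
def PiecewiseSmooth (γ : ℝ → ℂ) : Prop :=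
  ContinuousOn γ (Set.Icc 0 1) ∧
  ∃ (k : ℕ) (t : ℕ → ℝ), StrictMono t ∧ t 0 = 0 ∧ t k = 1 ∧
    ∀ i < k, ContDiffOn ℝ 1 γ (Set.Icc (t i) (t (i + 1))) ∧
      ∀ s ∈ Set.Icc (t i) (t (i + 1)), derivWithin γ (Set.Icc (t i) (t (i + 1))) s ≠ 0

/-- A piecewise smooth, simple, closed, counter-clockwise oriented curve in the plane.
Counter-clockwise orientation means, as usual for simple closed curves, that the winding number
about every point off the curve is `0` or `1` (for the opposite orientation it is `0` or `-1`). -/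
structure Contour where
  /-- the parametrisation; only its values on `[0,1]` matter -/
  param : ℝ → ℂ
  piecewiseSmooth : PiecewiseSmooth param
  closed : param 0 = param 1
  simple : Set.InjOn param (Set.Ico 0 1)
  counterclockwise : ∀ z, z ∉ param '' Set.Icc 0 1 →
    windingNumber param z = 0 ∨ windingNumber param z = 1

namespace Contour

variable (Γ : Contour)

/-- The curve as a set of points. -/
def trace : Set ℂ := Γ.param '' Set.Icc 0 1

/-- The points inside the curve. -/
def inside : Set ℂ := {z | z ∉ Γ.trace ∧ windingNumber Γ.param z = 1}

/-- The points outside the curve. -/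
def outside : Set ℂ := {z | z ∉ Γ.trace ∧ windingNumber Γ.param z = 0}

/-- The length of the curve. -/
def length : ℝ := ∫ t in (0 : ℝ)..1, ‖deriv Γ.param t‖

/-- Arc length measure on the curve, as a measure on `ℂ`. -/
def arcLength : Measure ℂ :=
  ((volume.restrict (Set.Icc (0 : ℝ) 1)).withDensity (fun t => ‖deriv Γ.param t‖ₑ)).map Γ.param

/-- The Cauchy operator `𝒞_Γ f (z) = (2πi)⁻¹ ∫_Γ f(w) / (w - z) dw`. -/
def cauchy (f : ℂ → ℂ) (z : ℂ) : ℂ := cauchyAlong Γ.param f z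

/-- The Cauchy operator applied to a matrix-valued function, entry by entry. -/
def cauchyMatrix (F : ℂ → Matrix (Fin 2) (Fin 2) ℂ) (z : ℂ) : Matrix (Fin 2) (Fin 2) ℂ :=
  Matrix.of fun i j => Γ.cauchy (fun w => F w i j) z

/-- The non-tangential approach region at `x ∈ Γ` of aperture `α`, in the exterior of `Γ`. -/
def exteriorApproach (α : ℝ) (x : ℂ) : Set ℂ :=
  {z | z ∈ Γ.outside ∧ dist z x ≤ α * Metric.infDist z Γ.trace}

/-- `g = 𝒞⁻_Γ f`: at almost every point `x` of `Γ`, `g x` is the non-tangential limit of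
`𝒞_Γ f` from the exterior of `Γ`. -/
def IsExteriorBoundaryValue (f g : ℂ → ℂ) : Prop :=
  ∀ᵐ x ∂Γ.arcLength, ∀ α : ℝ, 1 < α →
    Tendsto (Γ.cauchy f) (𝓝[Γ.exteriorApproach α x] x) (𝓝 (g x))

/-- The operator norm of `𝒞⁻_Γ` on `L²(Γ)` (with respect to arc length) is at most `C`: whenever
`f ∈ L²(Γ)` and `g = 𝒞⁻_Γ f`, one has `‖g‖ ≤ C ‖f‖`. -/
def ExteriorCauchyBound (C : NNReal) : Prop :=
  ∀ f g : ℂ → ℂ, MemLp f 2 Γ.arcLength → Γ.IsExteriorBoundaryValue f g →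
    eLpNorm g 2 Γ.arcLength ≤ C * eLpNorm f 2 Γ.arcLength

/-- The norm of a matrix-valued function in `L^∞(Γ)`. -/
def linftyNorm (F : ℂ → Matrix (Fin 2) (Fin 2) ℂ) : ℝ :=
  (eLpNorm F ⊤ Γ.arcLength).toReal

/-- The curve encircles the support of the measure `μ` on the real line. -/
def Encircles (μ : Measure ℝ) : Prop := ∀ x ∈ μ.support, (x : ℂ) ∈ Γ.inside

end Contour

/-! ### Orthogonal polynomials and their matrices -/

/-- The monic orthogonal polynomial `π_n(·; μ)`, by the Gram-Schmidt process. It is determined by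
orthogonality to all polynomials of degree `< n` when the support of `μ` has at least `n` points. -/
def monicOP (μ : Measure ℝ) : ℕ → ℝ[X]
  | n => X ^ n - ∑ k : Fin n,
      C ((∫ x, x ^ n * (monicOP μ k).eval x ∂μ) / (∫ x, (monicOP μ k).eval x ^ 2 ∂μ)) * monicOP μ k
  decreasing_by all_goals exact k.isLt

/-- `π_n(z; μ)` at a complex point. -/
def opEval (μ : Measure ℝ) (n : ℕ) (z : ℂ) : ℂ := aeval z (monicOP μ n)

/-- The Cauchy transform `c_n(z; μ) = (2πi)⁻¹ ∫ π_n(x; μ) / (x - z) μ(dx)`. -/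
def opCauchy (μ : Measure ℝ) (n : ℕ) (z : ℂ) : ℂ :=
  (2 * Real.pi * Complex.I)⁻¹ * ∫ x : ℝ, opEval μ n x / (x - z) ∂μ

/-- `γ_n(μ) = - 2πi ‖π_n(·; μ)‖_{L²(μ)}⁻²`. -/
def opGamma (μ : Measure ℝ) (n : ℕ) : ℂ :=
  -(2 * Real.pi * Complex.I) * ((∫ x, (monicOP μ n).eval x ^ 2 ∂μ : ℝ) : ℂ)⁻¹

/-- The matrix `Y_n(z; μ)`, for `n ≥ 1` and `z` off the support of `μ`. -/
def Y (μ : Measure ℝ) (n : ℕ) (z : ℂ) : Matrix (Fin 2) (Fin 2) ℂ :=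
  !![opEval μ n z, opCauchy μ n z;
     opGamma μ (n - 1) * opEval μ (n - 1) z, opGamma μ (n - 1) * opCauchy μ (n - 1) z]

open Classical in
/-- `Ỹ_n(z; μ)`: the matrix `Y_n` modified inside `Γ`. -/
def Ytilde (Γ : Contour) (μ : Measure ℝ) (n : ℕ) (z : ℂ) : Matrix (Fin 2) (Fin 2) ℂ :=
  if z ∈ Γ.inside then Y μ n z * !![1, -opCauchy μ 0 z; 0, 1] else Y μ n z

/-- `Y̌_n(z; μ) = 𝔠^{(n-p)σ₃} Ỹ_n(z; μ)`. On `Γ` itself the exterior formula applies; `Y_n(·; μ)`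
is continuous off the support of `μ`, so there this is the boundary value `Y̌_n⁻` from outside. -/
def Ycheck (Γ : Contour) (𝔠 : ℂ) (p : ℕ) (μ : Measure ℝ) (n : ℕ) (z : ℂ) :
    Matrix (Fin 2) (Fin 2) ℂ :=
  !![𝔠 ^ ((n : ℤ) - p), 0; 0, 𝔠 ^ (-((n : ℤ) - p))] * Ytilde Γ μ n z

/-- `X_n(z; μ, ν) = Y̌_n(z; ν) Y̌_n(z; μ)⁻¹`, for `z` off `Γ` and off the supports of `μ`, `ν`. -/
def Xmat (Γ : Contour) (𝔠 : ℂ) (p : ℕ) (μ ν : Measure ℝ) (n : ℕ) (z : ℂ) :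
    Matrix (Fin 2) (Fin 2) ℂ :=
  Ycheck Γ 𝔠 p ν n z * (Ycheck Γ 𝔠 p μ n z)⁻¹

/-- `M_n(z; μ) = Y̌_n⁻(z; μ) [0 1; 0 0] Y̌_n⁻(z; μ)⁻¹`, for `z ∈ Γ`. -/
def Mmat (Γ : Contour) (𝔠 : ℂ) (p : ℕ) (μ : Measure ℝ) (n : ℕ) (z : ℂ) :
    Matrix (Fin 2) (Fin 2) ℂ :=
  Ycheck Γ 𝔠 p μ n z * !![0, 1; 0, 0] * (Ycheck Γ 𝔠 p μ n z)⁻¹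

/-- `c_0(z; μ - ν)`. -/
def c0diff (μ ν : Measure ℝ) (z : ℂ) : ℂ := opCauchy μ 0 z - opCauchy ν 0 z

/-- The jump matrix `J_n(z; μ, ν) = I + c_0(z; μ - ν) M_n(z; μ)`, for `z ∈ Γ`. -/
def Jmat (Γ : Contour) (𝔠 : ℂ) (p : ℕ) (μ ν : Measure ℝ) (n : ℕ) (z : ℂ) :
    Matrix (Fin 2) (Fin 2) ℂ :=
  1 + c0diff μ ν z • Mmat Γ 𝔠 p μ n z

end RHPerturb

end

noncomputable section

namespace RHPerturb

/-! ### Piecewise smooth curves -/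

/-! The Riemann–Hilbert problem for `X_n` is solved explicitly, so neither the Plemelj formulas nor
a Liouville argument is needed. Let `Y(μ)` be the scaled exterior matrix `Yext`, `E = [0 1; 0 0]`,
and `P = Y(ν) E Y(μ)⁻¹`. Since `det Y(μ) = 1` and only the polynomial first columns enter, `P` is a
polynomial matrix (`jumpPoly`). Orthogonality moves polynomial factors into the Cauchy transforms,
which gives `Y(ν) Y(μ)⁻¹ = I + u`, where `u` is the Cauchy transform of `P` against `ν` minus that
against `μ` (`Yext_mul_inv_Yext`). By Fubini and Cauchy's formula for polynomials, the Cauchy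
integral over `Γ` of `f = c₀(μ - ν) P` is `u` outside and `u + c₀(μ - ν) P` inside
(`Contour.cauchy_c0diff_mul_eval`). These are the two expressions for `X_n - I`, so `I + 𝒞_Γ f`,
analytic off `Γ`, is the continuation (`Xcont_eq_Xmat`).

On `Γ` one has `P = (I + u) M_n`, hence `f = D + u D` with `D = J_n - I`. As `u` is analytic near
`Γ`, it is the exterior boundary value of `𝒞_Γ f`, so `‖u‖₂ ≤ C ‖f‖₂`. With `ε = ‖D‖_∞` and `C ε`
small, the `u` term on the right is absorbed, and `‖u‖₂ = O(C ε √length)`. The error `𝒞_Γ (u D)` is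
then `O(C ε² length / dist(z, Γ))` (`norm_Xcont_sub_le`). Bounded length, together with a point of
`supp μ` inside `Γ` and in a fixed interval, confines `Γ` to a fixed disc, and there `dist(z, Γ)` is
comparable with `1 + |z|`. -/

theorem exists_mem_Ioo_of_strictMono {t : ℕ → ℝ} {k : ℕ} {x : ℝ} (h0 : t 0 < x) (hk : x < t k)
    (hx : ∀ i, x ≠ t i) : ∃ i < k, x ∈ Set.Ioo (t i) (t (i + 1)) := by
  induction k with
  | zero => exact absurd h0 (not_lt.2 hk.le)
  | succ k ih =>
    rcases lt_or_gt_of_ne (hx k) with h | h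
    · obtain ⟨i, hi, hi'⟩ := ih h
      exact ⟨i, by omega, hi'⟩
    · exact ⟨k, by omega, h, hk⟩

theorem PiecewiseSmooth.exists_countable_hasDerivAt {γ : ℝ → ℂ} (h : PiecewiseSmooth γ) :
    ∃ s : Set ℝ, s.Countable ∧ ∀ x ∈ Set.Ioo (0 : ℝ) 1 \ s, HasDerivAt γ (deriv γ x) x := by
  obtain ⟨-, k, t, ht, h0, h1, hd⟩ := h
  refine ⟨Set.range t, Set.countable_range t, fun x hx => ?_⟩
  obtain ⟨i, hi, hxi⟩ := exists_mem_Ioo_of_strictMono (t := t) (k := k) (x := x)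
    (by rw [h0]; exact hx.1.1) (by rw [h1]; exact hx.1.2) (fun i h => hx.2 ⟨i, h.symm⟩)
  exact (((hd i hi).1.contDiffAt (Icc_mem_nhds hxi.1 hxi.2)).differentiableAt one_ne_zero).hasDerivAt

theorem PiecewiseSmooth.intervalIntegrable_deriv {γ : ℝ → ℂ} (h : PiecewiseSmooth γ) :
    IntervalIntegrable (deriv γ) volume 0 1 := by
  obtain ⟨-, k, t, ht, h0, h1, hd⟩ := h
  rw [← h0, ← h1]
  refine IntervalIntegrable.trans_iterate fun i hi => ?_
  have hlt : t i < t (i + 1) := ht (Nat.lt_succ_self i)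
  have hc := (hd i hi).1.continuousOn_derivWithin (uniqueDiffOn_Icc hlt) le_rfl
  have hint : IntervalIntegrable (derivWithin γ (Set.Icc (t i) (t (i + 1)))) volume
      (t i) (t (i + 1)) := by
    apply ContinuousOn.intervalIntegrable
    rwa [Set.uIcc_of_le hlt.le]
  -- At the break points `deriv γ` may take its default value 0; only the open pieces matter for
  -- integrability.
  refine hint.congr_uIoo fun x hx => ?_
  rw [Set.uIoo_of_le hlt.le] at hx
  exact derivWithin_of_mem_nhds (Icc_mem_nhds hx.1 hx.2)

theorem PiecewiseSmooth.integral_comp_mul_deriv_eq_zero {γ : ℝ → ℂ} (h : PiecewiseSmooth γ)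
    (hc : γ 0 = γ 1) {f F : ℂ → ℂ} (hF : ∀ w, HasDerivAt F (f w) w) (hf : Continuous f) :
    ∫ t in (0 : ℝ)..1, f (γ t) * deriv γ t = 0 := by
  obtain ⟨s, hs, hd⟩ := h.exists_countable_hasDerivAt
  have hcF : Continuous F := continuous_iff_continuousAt.2 fun w => (hF w).continuousAt
  rw [MeasureTheory.integral_eq_of_hasDerivAt_off_countable_of_le (fun t => F (γ t)) _ zero_le_one hs
    (hcF.comp_continuousOn h.1) (fun x hx => (hF (γ x)).comp x (hd x hx)) ?_, hc, sub_self]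
  · refine h.intervalIntegrable_deriv.continuousOn_mul (hf.comp_continuousOn ?_)
    rw [Set.uIcc_of_le zero_le_one]
    exact h.1

/-! ### Contour integrals of polynomials and of simple fractions -/

namespace Contour

variable (Γ : Contour)

theorem isCompact_trace : IsCompact Γ.trace :=
  isCompact_Icc.image_of_continuousOn Γ.piecewiseSmooth.1

theorem nonempty_trace : Γ.trace.Nonempty := ⟨Γ.param 0, 0, by simp, rfl⟩

theorem param_mem_trace {t : ℝ} (ht : t ∈ Set.Icc (0 : ℝ) 1) : Γ.param t ∈ Γ.trace := ⟨t, ht, rfl⟩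

theorem intervalIntegrable_mul_deriv {f : ℂ → ℂ} (hf : ContinuousOn f Γ.trace) :
    IntervalIntegrable (fun t => f (Γ.param t) * deriv Γ.param t) volume 0 1 := by
  refine Γ.piecewiseSmooth.intervalIntegrable_deriv.continuousOn_mul ?_
  rw [Set.uIcc_of_le zero_le_one]
  exact hf.comp Γ.piecewiseSmooth.1 fun t ht => Γ.param_mem_trace ht

theorem continuousOn_div_sub {f : ℂ → ℂ} (hf : ContinuousOn f Γ.trace) {z : ℂ} (hz : z ∉ Γ.trace) :
    ContinuousOn (fun w => f w / (w - z)) Γ.trace :=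
  hf.div (by fun_prop) fun w hw => sub_ne_zero.2 fun h => hz (h ▸ hw)

theorem cauchy_congr {f g : ℂ → ℂ} (h : Set.EqOn f g Γ.trace) (z : ℂ) :
    Γ.cauchy f z = Γ.cauchy g z := by
  unfold cauchy cauchyAlong
  congr 1
  refine intervalIntegral.integral_congr fun t ht => ?_
  rw [Set.uIcc_of_le zero_le_one] at ht
  simp only [h (Γ.param_mem_trace ht)]

theorem cauchy_sub {f g : ℂ → ℂ} (hf : ContinuousOn f Γ.trace) (hg : ContinuousOn g Γ.trace)
    {z : ℂ} (hz : z ∉ Γ.trace) :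
    Γ.cauchy (fun w => f w - g w) z = Γ.cauchy f z - Γ.cauchy g z := by
  unfold cauchy cauchyAlong
  rw [← mul_sub, ← intervalIntegral.integral_sub
    (Γ.intervalIntegrable_mul_deriv (Γ.continuousOn_div_sub hf hz))
    (Γ.intervalIntegrable_mul_deriv (Γ.continuousOn_div_sub hg hz))]
  simp only [sub_div, sub_mul]

theorem _root_.Polynomial.exists_hasDerivAt_eval (q : ℂ[X]) :
    ∃ F : ℂ → ℂ, ∀ w, HasDerivAt F (q.eval w) w := by
  induction q using Polynomial.induction_on' with
  | add p q hp hq =>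
    obtain ⟨F, hF⟩ := hp
    obtain ⟨G, hG⟩ := hq
    exact ⟨F + G, fun w => by simpa using (hF w).add (hG w)⟩
  | monomial n a =>
    refine ⟨fun w => a * (w ^ (n + 1) / (n + 1)), fun w => ?_⟩
    have h := ((hasDerivAt_pow (n + 1) w).div_const ((n : ℂ) + 1)).const_mul a
    refine h.congr_deriv ?_
    have : (n : ℂ) + 1 ≠ 0 := Nat.cast_add_one_ne_zero n
    simp only [Nat.cast_add, Nat.cast_one, add_tsub_cancel_right, eval_monomial]
    field_simp

theorem _root_.Polynomial.eval_eq_eval_add_sub_mul_divByMonic {R : Type*} [CommRing R] (P : R[X])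
    (w z : R) : P.eval w = P.eval z + (w - z) * (P /ₘ (X - C z)).eval w := by
  have h := congrArg (Polynomial.eval w) (Polynomial.X_sub_C_mul_divByMonic_eq_sub_modByMonic P z)
  simp only [eval_mul, eval_sub, eval_X, eval_C, modByMonic_X_sub_C_eq_C_eval] at h
  linear_combination -h

/-- Write `P(w) = P(z) + (w - z) q(w)`. The quotient `q` has a polynomial primitive, so it
integrates to zero around the closed curve. Only the constant `P(z)` remains, and it produces the
winding number. -/
theorem cauchy_eval (P : ℂ[X]) {z : ℂ} (hz : z ∉ Γ.trace) :
    Γ.cauchy (fun w => P.eval w) z = windingNumber Γ.param z * P.eval z := by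
  have h1 : Γ.cauchy (fun w => P.eval w) z =
      Γ.cauchy (fun _ => P.eval z) z +
        (2 * Real.pi * Complex.I)⁻¹ * ∫ t in (0 : ℝ)..1,
          (P /ₘ (X - C z)).eval (Γ.param t) * deriv Γ.param t := by
    have e1 := Γ.intervalIntegrable_mul_deriv
      (Γ.continuousOn_div_sub (f := fun _ => P.eval z) continuousOn_const hz)
    have e2 := Γ.intervalIntegrable_mul_deriv
      (f := fun w => (P /ₘ (X - C z)).eval w) (by fun_prop)
    unfold cauchy cauchyAlong
    beta_reduce at e1 e2 ⊢
    rw [← mul_add, ← intervalIntegral.integral_add e1 e2]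
    congr 1
    refine intervalIntegral.integral_congr fun t ht => ?_
    rw [Set.uIcc_of_le zero_le_one] at ht
    have hne : Γ.param t - z ≠ 0 := sub_ne_zero.2 fun h => hz (h ▸ Γ.param_mem_trace ht)
    rw [P.eval_eq_eval_add_sub_mul_divByMonic (Γ.param t) z]
    field_simp
  obtain ⟨F, hF⟩ := (P /ₘ (X - C z)).exists_hasDerivAt_eval
  rw [h1, Γ.piecewiseSmooth.integral_comp_mul_deriv_eq_zero Γ.closed hF (by fun_prop), mul_zero,
    add_zero]
  unfold cauchy windingNumber cauchyAlong
  beta_reduce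
  rw [mul_assoc ((2 * Real.pi * Complex.I : ℂ)⁻¹), ← intervalIntegral.integral_mul_const]
  congr 2
  ext t
  ring

/-- Partial fractions in `w` reduce this to `cauchy_eval` at `z` and at `x`. -/
theorem cauchy_eval_div_sub (P : ℂ[X]) {x z : ℂ} (hx : x ∉ Γ.trace) (hz : z ∉ Γ.trace)
    (hxz : x ≠ z) :
    Γ.cauchy (fun w => P.eval w / (x - w)) z =
      (windingNumber Γ.param z * P.eval z - windingNumber Γ.param x * P.eval x) / (x - z) := by
  have hxz' : x - z ≠ 0 := sub_ne_zero.2 hxz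
  rw [← Γ.cauchy_eval P hz, ← Γ.cauchy_eval P hx, eq_div_iff hxz']
  have e1 := Γ.intervalIntegrable_mul_deriv
    (Γ.continuousOn_div_sub (f := fun w => P.eval w) (by fun_prop) hz)
  have e2 := Γ.intervalIntegrable_mul_deriv
    (Γ.continuousOn_div_sub (f := fun w => P.eval w) (by fun_prop) hx)
  unfold cauchy cauchyAlong
  beta_reduce at e1 e2 ⊢
  rw [← mul_sub, ← intervalIntegral.integral_sub e1 e2, mul_assoc, ← intervalIntegral.integral_mul_const]
  congr 1
  refine intervalIntegral.integral_congr fun t ht => ?_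
  rw [Set.uIcc_of_le zero_le_one] at ht
  have h1 : Γ.param t - z ≠ 0 := sub_ne_zero.2 fun h => hz (h ▸ Γ.param_mem_trace ht)
  have h2 : Γ.param t - x ≠ 0 := sub_ne_zero.2 fun h => hx (h ▸ Γ.param_mem_trace ht)
  have h3 : x - Γ.param t ≠ 0 := by rwa [← neg_ne_zero, neg_sub]
  field_simp
  ring

end Contour

/-! ### Cauchy transforms -/

/-- Differentiation under the integral sign. The general kernel serves both Cauchy transforms of
measures on the line and Cauchy integrals along a parametrised curve. -/
theorem differentiableOn_integral_div_sub {α : Type*} [MeasurableSpace α] {m : Measure α}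
    {h k : α → ℂ} (hh : Integrable h m) (hk : AEStronglyMeasurable k m) {S : Set ℂ}
    (hS : IsClosed S) (hkS : ∀ᵐ a ∂m, k a ∈ S) :
    DifferentiableOn ℂ (fun z => ∫ a, h a / (k a - z) ∂m) Sᶜ := by
  intro z₀ hz₀
  obtain ⟨r, hr, hball⟩ := Metric.isOpen_iff.1 hS.isOpen_compl z₀ hz₀
  -- Halving the radius keeps `|k a - z| ≥ r / 2` uniformly on the ball, which gives an integrable
  -- majorant of the derivative.
  have hr2 : 0 < r / 2 := by positivity
  have hdist : ∀ a, k a ∈ S → ∀ z ∈ Metric.ball z₀ (r / 2), r / 2 ≤ ‖k a - z‖ := by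
    intro a ha z hz
    have h1 : r ≤ dist (k a) z₀ := by
      by_contra hlt
      exact hball (Metric.mem_ball.2 (not_le.1 hlt)) ha
    have h2 := dist_triangle (k a) z z₀
    rw [← dist_eq_norm]
    have := Metric.mem_ball.1 hz
    linarith
  have hmeas : ∀ z, AEStronglyMeasurable (fun a => h a / (k a - z)) m := fun z =>
    (hh.aestronglyMeasurable.aemeasurable.div
      (hk.aemeasurable.sub_const z)).aestronglyMeasurable
  have hbd : ∀ᵐ a ∂m, ∀ z ∈ Metric.ball z₀ (r / 2),
      ‖h a / (k a - z) ^ 2‖ ≤ ‖h a‖ / (r / 2) ^ 2 := by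
    filter_upwards [hkS] with a ha z hz
    rw [norm_div, norm_pow]
    gcongr
    exact hdist a ha z hz
  refine (hasDerivAt_integral_of_dominated_loc_of_deriv_le (𝕜 := ℂ)
    (F' := fun z a => h a / (k a - z) ^ 2)
    (Metric.ball_mem_nhds z₀ hr2) (Eventually.of_forall hmeas) ?_ ?_ hbd
    (hh.norm.div_const _) ?_).2.differentiableAt.differentiableWithinAt
  · refine (hh.norm.div_const (r / 2)).mono' (hmeas z₀) ?_
    filter_upwards [hkS] with a ha
    rw [norm_div]
    gcongr
    exact hdist a ha z₀ (Metric.mem_ball_self hr2)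
  · exact (hh.aestronglyMeasurable.aemeasurable.div
      ((hk.aemeasurable.sub_const z₀).pow_const 2)).aestronglyMeasurable
  · filter_upwards [hkS] with a ha z hz
    have hne : k a - z ≠ 0 := norm_pos_iff.1 (hr2.trans_le (hdist a ha z hz))
    have := (hasDerivAt_const z (h a)).div ((hasDerivAt_id z).const_sub (k a)) hne
    refine this.congr_deriv ?_
    simp

/-- The Cauchy transform `(2πi)⁻¹ ∫ Q(x) / (x - z) μ(dx)` of `Q μ`. -/
def cauchyTransform (μ : Measure ℝ) (Q : ℂ[X]) (z : ℂ) : ℂ :=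
  (2 * Real.pi * Complex.I)⁻¹ * ∫ x : ℝ, Q.eval (x : ℂ) / (x - z) ∂μ

theorem integrable_of_isCompact_support {μ : Measure ℝ} [IsFiniteMeasure μ]
    (hμ : IsCompact μ.support) {f : ℝ → ℂ} (hf : ContinuousOn f μ.support) : Integrable f μ := by
  have h := hf.integrableOn_compact hμ (μ := μ)
  have hs : ∀ᵐ x ∂μ, x ∈ μ.support := Measure.support_mem_ae
  rwa [IntegrableOn, Measure.restrict_eq_self_of_ae_mem hs] at h

theorem isCompact_ofReal_support {μ : Measure ℝ} (hμ : IsCompact μ.support) :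
    IsCompact (Complex.ofReal '' μ.support) := hμ.image Complex.continuous_ofReal

theorem differentiableOn_cauchyTransform {μ : Measure ℝ} [IsFiniteMeasure μ]
    (hμ : IsCompact μ.support) (Q : ℂ[X]) :
    DifferentiableOn ℂ (cauchyTransform μ Q) (Complex.ofReal '' μ.support)ᶜ := by
  refine DifferentiableOn.const_mul ?_ _
  refine differentiableOn_integral_div_sub (m := μ) (h := fun x : ℝ => Q.eval (x : ℂ))
    (k := Complex.ofReal) (integrable_of_isCompact_support hμ (by fun_prop)) (by fun_prop)
    (isCompact_ofReal_support hμ).isClosed ?_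
  filter_upwards [Measure.support_mem_ae (μ := μ)] with x hx using ⟨x, hx, rfl⟩

theorem continuousOn_eval_div_sub {μ : Measure ℝ} (Q : ℂ[X]) {z : ℂ}
    (hz : z ∉ Complex.ofReal '' μ.support) :
    ContinuousOn (fun x : ℝ => Q.eval (x : ℂ) / (x - z)) μ.support :=
  ContinuousOn.div (by fun_prop) (by fun_prop) fun x hx =>
    sub_ne_zero.2 fun h => hz ⟨x, hx, h⟩

theorem cauchyTransform_C_mul (μ : Measure ℝ) (a : ℂ) (Q : ℂ[X]) (z : ℂ) :
    cauchyTransform μ (C a * Q) z = a * cauchyTransform μ Q z := by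
  unfold cauchyTransform
  simp only [eval_mul, eval_C, mul_div_assoc]
  rw [integral_const_mul, mul_left_comm]

/-- The difference `P(z) - P(x)` is divisible by `x - z`, so the singular kernel cancels and the
integral of a polynomial is left, to which orthogonality applies. -/
theorem eval_mul_cauchyTransform_sub {μ : Measure ℝ} [IsFiniteMeasure μ]
    (hμ : IsCompact μ.support) (P Q : ℂ[X]) {z : ℂ} (hz : z ∉ Complex.ofReal '' μ.support) :
    P.eval z * cauchyTransform μ Q z - cauchyTransform μ (P * Q) z =
      -((2 * Real.pi * Complex.I)⁻¹ *
        ∫ x : ℝ, Q.eval (x : ℂ) * (P /ₘ (X - C z)).eval (x : ℂ) ∂μ) := by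
  unfold cauchyTransform
  have e1 := (integrable_of_isCompact_support hμ (continuousOn_eval_div_sub Q hz)).const_mul
    (P.eval z)
  have e2 := integrable_of_isCompact_support hμ (continuousOn_eval_div_sub (P * Q) hz)
  rw [mul_left_comm, ← mul_sub, ← integral_const_mul, ← integral_sub e1 e2, ← mul_neg,
    ← integral_neg]
  congr 1
  refine integral_congr_ae ?_
  filter_upwards [Measure.support_mem_ae (μ := μ)] with x hx
  have hne : (x : ℂ) - z ≠ 0 := sub_ne_zero.2 fun h => hz ⟨x, hx, h⟩
  rw [eval_mul, P.eval_eq_eval_add_sub_mul_divByMonic (x : ℂ) z]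
  field_simp
  ring

/-! ### Contour integrals of Cauchy transforms -/

namespace Contour

variable (Γ : Contour)

theorem notMem_trace_of_encircles {μ : Measure ℝ} (h : Γ.Encircles μ) {w : ℂ}
    (hw : w ∈ Γ.trace) : w ∉ Complex.ofReal '' μ.support := by
  rintro ⟨x, hx, rfl⟩
  exact (h x hx).1 hw

theorem notMem_support_of_outside {μ : Measure ℝ} (h : Γ.Encircles μ) {w : ℂ}
    (hw : w ∈ Γ.outside) : w ∉ Complex.ofReal '' μ.support := by
  rintro ⟨x, hx, rfl⟩
  exact one_ne_zero ((h x hx).2.symm.trans hw.2)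

theorem inside_or_outside {z : ℂ} (hz : z ∉ Γ.trace) : z ∈ Γ.inside ∨ z ∈ Γ.outside :=
  (Γ.counterclockwise z hz).symm.imp (fun h => ⟨hz, h⟩) fun h => ⟨hz, h⟩

theorem continuousOn_cauchyTransform {μ : Measure ℝ} [IsFiniteMeasure μ]
    (hμ : IsCompact μ.support) (h : Γ.Encircles μ) (Q : ℂ[X]) :
    ContinuousOn (cauchyTransform μ Q) Γ.trace :=
  (differentiableOn_cauchyTransform hμ Q).continuousOn.mono
    fun _ hw => Γ.notMem_trace_of_encircles h hw

theorem aestronglyMeasurable_param :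
    AEStronglyMeasurable Γ.param (volume.restrict (Set.uIoc (0 : ℝ) 1)) := by
  rw [Set.uIoc_of_le zero_le_one]
  exact (Γ.piecewiseSmooth.1.aestronglyMeasurable measurableSet_Icc).mono_measure
    (Measure.restrict_mono Set.Ioc_subset_Icc_self le_rfl)

theorem differentiableOn_cauchy {f : ℂ → ℂ} (hf : ContinuousOn f Γ.trace) :
    DifferentiableOn ℂ (Γ.cauchy f) Γ.traceᶜ := by
  refine DifferentiableOn.const_mul ?_ _
  have h := differentiableOn_integral_div_sub
    (Γ.intervalIntegrable_mul_deriv hf).def' Γ.aestronglyMeasurable_param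
    Γ.isCompact_trace.isClosed ?_
  · refine h.congr fun z hz => ?_
    rw [intervalIntegral.integral_of_le zero_le_one, Set.uIoc_of_le zero_le_one]
    congr 1
    ext t
    ring
  · refine (ae_restrict_iff' measurableSet_uIoc).2 (Eventually.of_forall fun t ht => ?_)
    rw [Set.uIoc_of_le zero_le_one] at ht
    exact Γ.param_mem_trace (Set.Ioc_subset_Icc_self ht)

/-- Fubini reduces the claim to `cauchy_eval_div_sub` for each `x` in the support. The winding
number about such `x` is 1 because `Γ` encircles the support; this residue is the subtracted term.
-/
theorem cauchy_eval_mul_cauchyTransform_one {μ : Measure ℝ} [IsFiniteMeasure μ]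
    (hμ : IsCompact μ.support) (h : Γ.Encircles μ) (P : ℂ[X]) {z : ℂ} (hz : z ∉ Γ.trace)
    (hzμ : z ∉ Complex.ofReal '' μ.support) :
    Γ.cauchy (fun w => P.eval w * cauchyTransform μ 1 w) z =
      windingNumber Γ.param z * (P.eval z * cauchyTransform μ 1 z) - cauchyTransform μ P z := by
  have key : Γ.cauchy (fun w => P.eval w * cauchyTransform μ 1 w) z =
      (2 * Real.pi * Complex.I)⁻¹ * ∫ x : ℝ, Γ.cauchy (fun w => P.eval w / (x - w)) z ∂μ := by
    unfold cauchy cauchyAlong cauchyTransform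
    beta_reduce
    rw [integral_const_mul]
    congr 1
    rw [← intervalIntegral_integral_swap, ← intervalIntegral.integral_const_mul]
    · refine intervalIntegral.integral_congr fun t _ => ?_
      rw [mul_left_comm, mul_div_assoc, mul_assoc]
      congr 1
      rw [← integral_const_mul, ← integral_div, ← integral_mul_const]
      refine integral_congr_ae (Eventually.of_forall fun x => ?_)
      beta_reduce
      rw [eval_one]
      ring
    -- Justification of Fubini: apart from `γ'`, the integrand is continuous on the compact set
    -- `Γ.trace ×ˢ μ.support`, hence bounded, and `γ'` is integrable.
    · have hcont : ContinuousOn (fun p : ℂ × ℝ => P.eval p.1 / (p.2 - p.1) / (p.1 - z))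
          (Γ.trace ×ˢ μ.support) := by
        refine ContinuousOn.div (ContinuousOn.div (by fun_prop) (by fun_prop) ?_) (by fun_prop) ?_
        · rintro ⟨w, x⟩ ⟨hw, hx⟩
          exact sub_ne_zero.2 fun he => Γ.notMem_trace_of_encircles h hw ⟨x, hx, he⟩
        · rintro ⟨w, x⟩ ⟨hw, hx⟩
          exact sub_ne_zero.2 fun he => hz (he ▸ hw)
      obtain ⟨B, hB⟩ := (Γ.isCompact_trace.prod hμ).exists_bound_of_continuousOn hcont
      have hderiv := Γ.piecewiseSmooth.intervalIntegrable_deriv.def'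
      have hγ := Γ.aestronglyMeasurable_param.aemeasurable.comp_quasiMeasurePreserving
        (Measure.quasiMeasurePreserving_fst (ν := μ))
      have hd := hderiv.aestronglyMeasurable.aemeasurable.comp_quasiMeasurePreserving
        (Measure.quasiMeasurePreserving_fst (ν := μ))
      have hP : Measurable fun w : ℂ => P.eval w := by fun_prop
      have h1 : ∀ᵐ t ∂(volume.restrict (Set.uIoc (0 : ℝ) 1)), Γ.param t ∈ Γ.trace := by
        refine (ae_restrict_iff' measurableSet_uIoc).2 (Eventually.of_forall fun t ht => ?_)
        rw [Set.uIoc_of_le zero_le_one] at ht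
        exact Γ.param_mem_trace (Set.Ioc_subset_Icc_self ht)
      have h2 : ∀ᵐ x ∂μ, x ∈ μ.support := Measure.support_mem_ae
      refine ((hderiv.norm.comp_fst μ).const_mul B).mono' ?_ ?_
      · exact ((((hP.comp_aemeasurable hγ).div
          ((Complex.measurable_ofReal.comp measurable_snd).aemeasurable.sub hγ)).div
          (hγ.sub_const z)).mul hd).aestronglyMeasurable
      · filter_upwards [Measure.quasiMeasurePreserving_fst.ae h1,
          Measure.quasiMeasurePreserving_snd.ae h2] with p hp1 hp2
        rw [Function.uncurry, norm_mul]
        exact mul_le_mul_of_nonneg_right (hB (Γ.param p.1, p.2) ⟨hp1, hp2⟩) (norm_nonneg _)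
  rw [key]
  have h2 : ∀ᵐ x : ℝ ∂μ, Γ.cauchy (fun w => P.eval w / (x - w)) z =
      windingNumber Γ.param z * P.eval z * ((1 : ℂ[X]).eval (x : ℂ) / (x - z)) -
        P.eval (x : ℂ) / (x - z) := by
    filter_upwards [Measure.support_mem_ae (μ := μ)] with x hx
    rw [Γ.cauchy_eval_div_sub P (h x hx).1 hz (fun he => hzμ ⟨x, hx, he⟩), (h x hx).2, eval_one]
    ring
  rw [integral_congr_ae h2, integral_sub
    ((integrable_of_isCompact_support hμ (continuousOn_eval_div_sub 1 hzμ)).const_mul _)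
    (integrable_of_isCompact_support hμ (continuousOn_eval_div_sub P hzμ)), integral_const_mul]
  unfold cauchyTransform
  ring

end Contour

/-! ### Orthogonality -/

theorem monicOP_eq (μ : Measure ℝ) (n : ℕ) :
    monicOP μ n = X ^ n - ∑ k : Fin n,
      C ((∫ x, x ^ n * (monicOP μ k).eval x ∂μ) / (∫ x, (monicOP μ k).eval x ^ 2 ∂μ)) *
        monicOP μ k := by
  conv_lhs => unfold monicOP

theorem monicOP_monic_natDegree (μ : Measure ℝ) (n : ℕ) :
    (monicOP μ n).Monic ∧ (monicOP μ n).natDegree = n := by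
  induction n using Nat.strong_induction_on with
  | _ n ih =>
    have hdeg : (∑ k : Fin n,
        C ((∫ x, x ^ n * (monicOP μ k).eval x ∂μ) / (∫ x, (monicOP μ k).eval x ^ 2 ∂μ)) *
          monicOP μ k).degree < (n : ℕ) := by
      refine degree_lt_iff_coeff_zero _ _ |>.2 fun m hm => ?_
      rw [finsetSum_coeff]
      refine Finset.sum_eq_zero fun k _ => ?_
      rw [coeff_C_mul, coeff_eq_zero_of_natDegree_lt, mul_zero]
      rw [(ih k k.2).2]
      exact k.2.trans_le hm
    rw [monicOP_eq]
    refine ⟨monic_X_pow_sub hdeg, ?_⟩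
    refine natDegree_eq_of_degree_eq_some ?_
    rw [degree_sub_eq_left_of_degree_lt, degree_X_pow]
    rwa [degree_X_pow]

theorem monicOP_monic (μ : Measure ℝ) (n : ℕ) : (monicOP μ n).Monic :=
  (monicOP_monic_natDegree μ n).1

theorem natDegree_monicOP (μ : Measure ℝ) (n : ℕ) : (monicOP μ n).natDegree = n :=
  (monicOP_monic_natDegree μ n).2

section Orthogonality

variable {μ : Measure ℝ} [IsFiniteMeasure μ]

theorem integrable_real_of_isCompact_support (hμ : IsCompact μ.support) {f : ℝ → ℝ}
    (hf : Continuous f) : Integrable f μ :=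
  (integrable_of_isCompact_support hμ
    (f := fun x => (f x : ℂ)) (by fun_prop)).re.congr (by simp)

/-- If the integral vanished, the support would lie in the zero set of `P`, which has fewer than `n`
points. -/
theorem integral_eval_sq_ne_zero (hμ : IsCompact μ.support) {n : ℕ}
    (hn : (n : ℕ∞) ≤ μ.support.encard) {P : ℝ[X]} (hP : P ≠ 0) (hdeg : P.natDegree < n) :
    ∫ x, P.eval x ^ 2 ∂μ ≠ 0 := by
  intro h0
  rw [integral_eq_zero_iff_of_nonneg (fun x => sq_nonneg _)
    (integrable_real_of_isCompact_support hμ (f := fun x => P.eval x ^ 2)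
      (P.continuous.pow 2))] at h0
  have hsub : μ.support ⊆ (P.roots.toFinset : Set ℝ) := by
    refine Measure.support_subset_of_isClosed (Finset.finite_toSet _).isClosed ?_
    filter_upwards [h0] with x hx
    simpa [hP] using hx
  have h1 := hn.trans (Set.encard_le_encard hsub)
  rw [Set.encard_coe_eq_coe_finsetCard, Nat.cast_le] at h1
  have h2 := P.roots.toFinset_card_le
  have h3 := P.card_roots'
  omega

theorem integral_monicOP_sq_ne_zero (hμ : IsCompact μ.support) {n : ℕ}
    (hn : (n : ℕ∞) ≤ μ.support.encard) {k : ℕ} (hk : k < n) :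
    ∫ x, (monicOP μ k).eval x ^ 2 ∂μ ≠ 0 :=
  integral_eval_sq_ne_zero hμ hn (monicOP_monic μ k).ne_zero (by rwa [natDegree_monicOP])

/-- The case `m = n` is allowed: the Gram–Schmidt quotients for `π_m` divide only by norms of index
below `m`, which are nonzero. The norm of `π_n` itself may be zero, when the support has exactly `n`
points. -/
theorem integral_monicOP_mul_monicOP (hμ : IsCompact μ.support) {n : ℕ}
    (hn : (n : ℕ∞) ≤ μ.support.encard) {m : ℕ} (hm : m ≤ n) {k : ℕ} (hk : k < m) :
    ∫ x, (monicOP μ m).eval x * (monicOP μ k).eval x ∂μ = 0 := by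
  induction m using Nat.strong_induction_on generalizing k with
  | _ m ih =>
    have hint : ∀ {f : ℝ → ℝ}, Continuous f → Integrable f μ :=
      integrable_real_of_isCompact_support hμ
    have hsum : ∫ x, (monicOP μ m).eval x * (monicOP μ k).eval x ∂μ =
        ∫ x, x ^ m * (monicOP μ k).eval x ∂μ - ∑ j : Fin m,
          ((∫ x, x ^ m * (monicOP μ j).eval x ∂μ) / (∫ x, (monicOP μ j).eval x ^ 2 ∂μ)) *
            ∫ x, (monicOP μ j).eval x * (monicOP μ k).eval x ∂μ := by
      simp_rw [← integral_const_mul]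
      rw [← integral_finsetSum _ fun j _ => hint (by fun_prop),
        ← integral_sub (hint (by fun_prop)) (hint (by fun_prop))]
      refine integral_congr_ae (Eventually.of_forall fun x => ?_)
      beta_reduce
      rw [monicOP_eq μ m]
      simp only [eval_sub, eval_pow, eval_X, eval_finsetSum, eval_mul, eval_C, sub_mul,
        Finset.sum_mul, mul_assoc]
    -- By induction only the term `j = k` of the projection survives, and it cancels the leading
    -- integral.
    rw [hsum, Finset.sum_eq_single ⟨k, hk⟩, sub_eq_zero]
    · have h := integral_monicOP_sq_ne_zero hμ hn (hk.trans_le hm)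
      simp only [← sq]
      field_simp
    · intro j _ hj
      have hjk : (j : ℕ) ≠ k := fun h => hj (Fin.ext h)
      rcases lt_or_gt_of_ne hjk with h | h
      · simp_rw [mul_comm ((monicOP μ j).eval _)]
        rw [ih k hk (hk.le.trans hm) h, mul_zero]
      · rw [ih j j.2 (j.2.le.trans hm) h, mul_zero]
    · simp

theorem integral_monicOP_mul_eq_zero (hμ : IsCompact μ.support) {n : ℕ}
    (hn : (n : ℕ∞) ≤ μ.support.encard) {m : ℕ} (hm : m ≤ n) {d : ℕ} (hd : d ≤ m) {Q : ℝ[X]}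
    (hQ : Q.degree < d) : ∫ x, (monicOP μ m).eval x * Q.eval x ∂μ = 0 := by
  induction d generalizing Q with
  | zero =>
    have : Q = 0 := by simpa using hQ
    simp [this]
  | succ d ih =>
    -- Since `π_d` is monic of degree `d`, this subtraction removes the top coefficient of `Q`.
    have hlow : (Q - C (Q.coeff d) * monicOP μ d).degree < d := by
      refine (degree_lt_iff_coeff_zero _ _).2 fun j hj => ?_
      rw [coeff_sub, coeff_C_mul]
      rcases hj.eq_or_lt with rfl | hj
      · have := (monicOP_monic μ d).coeff_natDegree
        rw [natDegree_monicOP] at this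
        rw [this, mul_one, sub_self]
      · rw [coeff_eq_zero_of_natDegree_lt (p := monicOP μ d) (by rwa [natDegree_monicOP]),
          (degree_lt_iff_coeff_zero _ _).1 hQ j hj, mul_zero, sub_zero]
    have h1 := ih (Nat.le_of_succ_le hd) hlow
    have h2 := integral_monicOP_mul_monicOP hμ hn hm hd
    have hint : ∀ {f : ℝ → ℝ}, Continuous f → Integrable f μ :=
      integrable_real_of_isCompact_support hμ
    calc ∫ x, (monicOP μ m).eval x * Q.eval x ∂μ
        = ∫ x, ((monicOP μ m).eval x * (Q - C (Q.coeff d) * monicOP μ d).eval x +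
            Q.coeff d * ((monicOP μ m).eval x * (monicOP μ d).eval x)) ∂μ := by
          refine integral_congr_ae (Eventually.of_forall fun x => ?_)
          simp only [eval_sub, eval_mul, eval_C]
          ring
      _ = 0 := by
          rw [integral_add (hint (by fun_prop)) (hint (by fun_prop)), integral_const_mul, h1, h2,
            mul_zero, add_zero]

theorem integral_monicOP_mul_pow_self (hμ : IsCompact μ.support) {n : ℕ}
    (hn : (n : ℕ∞) ≤ μ.support.encard) {m : ℕ} (hm : m ≤ n) :
    ∫ x, (monicOP μ m).eval x * x ^ m ∂μ = ∫ x, (monicOP μ m).eval x ^ 2 ∂μ := by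
  have hlow : (X ^ m - monicOP μ m).degree < (m : WithBot ℕ) := by
    have h := degree_sub_lt_left (p := X ^ m) (q := monicOP μ m) ?_ (pow_ne_zero _ X_ne_zero) ?_
    · rwa [degree_X_pow] at h
    · rw [degree_X_pow, degree_eq_natDegree (monicOP_monic μ m).ne_zero, natDegree_monicOP]
    · rw [(monic_X_pow m).leadingCoeff, (monicOP_monic μ m).leadingCoeff]
  have h1 := integral_monicOP_mul_eq_zero hμ hn hm le_rfl hlow
  have hint : ∀ {f : ℝ → ℝ}, Continuous f → Integrable f μ :=
    integrable_real_of_isCompact_support hμ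
  rw [← sub_eq_zero, ← integral_sub (hint (by fun_prop)) (hint (by fun_prop)), ← h1]
  refine integral_congr_ae (Eventually.of_forall fun x => ?_)
  simp only [eval_sub, eval_pow, eval_X]
  ring

/-- The monic orthogonal polynomial as a polynomial over `ℂ`. -/
def complexOP (μ : Measure ℝ) (n : ℕ) : ℂ[X] := (monicOP μ n).map (algebraMap ℝ ℂ)

theorem complexOP_monic (μ : Measure ℝ) (n : ℕ) : (complexOP μ n).Monic :=
  (monicOP_monic μ n).map _

theorem natDegree_complexOP (μ : Measure ℝ) (n : ℕ) : (complexOP μ n).natDegree = n := by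
  rw [complexOP, (monicOP_monic μ n).natDegree_map, natDegree_monicOP]

theorem opEval_eq (μ : Measure ℝ) (n : ℕ) (z : ℂ) : opEval μ n z = (complexOP μ n).eval z := by
  rw [opEval, complexOP, eval_map_algebraMap]

theorem eval_ofReal_complexOP (μ : Measure ℝ) (n : ℕ) (x : ℝ) :
    (complexOP μ n).eval (x : ℂ) = ((monicOP μ n).eval x : ℝ) := by
  rw [complexOP]
  exact eval_map_apply (algebraMap ℝ ℂ) x

theorem integral_complexOP_mul (hμ : IsCompact μ.support) {n : ℕ}
    (hn : (n : ℕ∞) ≤ μ.support.encard) {m : ℕ} (hm : m ≤ n) {Q : ℂ[X]} (hQ : Q.natDegree ≤ m) :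
    ∫ x : ℝ, (complexOP μ m).eval (x : ℂ) * Q.eval (x : ℂ) ∂μ =
      Q.coeff m * ((∫ x, (monicOP μ m).eval x ^ 2 ∂μ : ℝ) : ℂ) := by
  have hpow : ∀ j : ℕ, ∫ x : ℝ, (complexOP μ m).eval (x : ℂ) * (x : ℂ) ^ j ∂μ =
      ((∫ x, (monicOP μ m).eval x * x ^ j ∂μ : ℝ) : ℂ) := by
    intro j
    rw [← integral_complex_ofReal]
    refine integral_congr_ae (Eventually.of_forall fun x => ?_)
    beta_reduce
    rw [eval_ofReal_complexOP]
    push_cast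
    rfl
  have h1 : ∀ x : ℝ, (complexOP μ m).eval (x : ℂ) * Q.eval (x : ℂ) =
      ∑ j ∈ Finset.range (m + 1),
        Q.coeff j * ((complexOP μ m).eval (x : ℂ) * (x : ℂ) ^ j) := by
    intro x
    rw [eval_eq_sum_range' (Nat.lt_succ_of_le hQ), Finset.mul_sum]
    refine Finset.sum_congr rfl fun j _ => by ring
  simp_rw [h1]
  rw [integral_finsetSum _ fun j _ => integrable_of_isCompact_support hμ (by fun_prop)]
  simp_rw [integral_const_mul, hpow]
  rw [Finset.sum_range_succ, integral_monicOP_mul_pow_self hμ hn hm, Finset.sum_eq_zero, zero_add]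
  intro j hj
  have h := integral_monicOP_mul_eq_zero hμ hn hm (Finset.mem_range.1 hj)
    (Q := X ^ j) (by rw [degree_X_pow]; exact_mod_cast Nat.lt_succ_self j)
  simp only [eval_pow, eval_X] at h
  rw [h, Complex.ofReal_zero, mul_zero]

/-- The quotient of `P` by `X - z` has degree at most `m`, so its pairing with `π_m` sees only its
coefficient of degree `m`, which is the coefficient of `P` in degree `m + 1`. -/
theorem eval_mul_cauchyTransform_complexOP_sub (hμ : IsCompact μ.support) {n : ℕ}
    (hn : (n : ℕ∞) ≤ μ.support.encard) {m : ℕ} (hm : m ≤ n) {P : ℂ[X]}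
    (hP : P.natDegree ≤ m + 1) {z : ℂ} (hz : z ∉ Complex.ofReal '' μ.support) :
    P.eval z * cauchyTransform μ (complexOP μ m) z - cauchyTransform μ (P * complexOP μ m) z =
      -((2 * Real.pi * Complex.I)⁻¹ *
        (P.coeff (m + 1) * ((∫ x, (monicOP μ m).eval x ^ 2 ∂μ : ℝ) : ℂ))) := by
  have hdeg : (P /ₘ (X - C z)).natDegree ≤ m := by
    rw [natDegree_divByMonic _ (monic_X_sub_C z), natDegree_X_sub_C]
    omega
  rw [eval_mul_cauchyTransform_sub hμ _ _ hz, integral_complexOP_mul hμ hn hm hdeg]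
  have hc : (P /ₘ (X - C z)).coeff m = P.coeff (m + 1) := by
    have h := congrArg (fun q => Polynomial.coeff q (m + 1))
      (X_sub_C_mul_divByMonic_eq_sub_modByMonic P z)
    simp only [sub_mul, coeff_sub, coeff_X_mul, coeff_C_mul, modByMonic_X_sub_C_eq_C_eval,
      coeff_C_succ, sub_zero] at h
    rw [← h, coeff_eq_zero_of_natDegree_lt (Nat.lt_succ_of_le hdeg), mul_zero, sub_zero]
  rw [hc]

theorem eval_mul_cauchyTransform_complexOP (hμ : IsCompact μ.support) {n : ℕ}
    (hn : (n : ℕ∞) ≤ μ.support.encard) {m : ℕ} (hm : m ≤ n) {P : ℂ[X]}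
    (hP : P.natDegree ≤ m) {z : ℂ} (hz : z ∉ Complex.ofReal '' μ.support) :
    P.eval z * cauchyTransform μ (complexOP μ m) z = cauchyTransform μ (P * complexOP μ m) z := by
  have h := eval_mul_cauchyTransform_complexOP_sub hμ hn hm (hP.trans (Nat.le_succ m)) hz
  rw [coeff_eq_zero_of_natDegree_lt (Nat.lt_succ_of_le hP), zero_mul, mul_zero, neg_zero,
    sub_eq_zero] at h
  exact h

/-- This is where the normalisation of `γ_m` enters: it cancels the factor `-(2πi)⁻¹ ‖π_m‖²`. -/
theorem opGamma_mul_eval_mul_cauchyTransform_complexOP_sub (hμ : IsCompact μ.support) {n : ℕ}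
    (hn : (n : ℕ∞) ≤ μ.support.encard) {m : ℕ} (hm : m < n) {P : ℂ[X]}
    (hP : P.Monic) (hPm : P.natDegree = m + 1) {z : ℂ} (hz : z ∉ Complex.ofReal '' μ.support) :
    opGamma μ m * (P.eval z * cauchyTransform μ (complexOP μ m) z -
      cauchyTransform μ (P * complexOP μ m) z) = 1 := by
  rw [eval_mul_cauchyTransform_complexOP_sub hμ hn hm.le hPm.le hz, ← hPm, hP.coeff_natDegree,
    opGamma]
  have h1 : ((∫ x, (monicOP μ m).eval x ^ 2 ∂μ : ℝ) : ℂ) ≠ 0 :=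
    Complex.ofReal_ne_zero.2 (integral_monicOP_sq_ne_zero hμ hn hm)
  have h2 : (2 * Real.pi * Complex.I : ℂ) ≠ 0 := Complex.two_pi_I_ne_zero
  rw [one_mul]
  calc _ = ((2 * Real.pi * Complex.I : ℂ) * (2 * Real.pi * Complex.I : ℂ)⁻¹) *
        (((∫ x, (monicOP μ m).eval x ^ 2 ∂μ : ℝ) : ℂ)⁻¹ *
          ((∫ x, (monicOP μ m).eval x ^ 2 ∂μ : ℝ) : ℂ)) := by ring
    _ = 1 := by rw [mul_inv_cancel₀ h2, inv_mul_cancel₀ h1, one_mul]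

theorem opCauchy_eq (μ : Measure ℝ) (n : ℕ) (z : ℂ) :
    opCauchy μ n z = cauchyTransform μ (complexOP μ n) z := by
  simp only [opCauchy, cauchyTransform, opEval_eq]

theorem complexOP_zero (μ : Measure ℝ) : complexOP μ 0 = 1 := by
  rw [complexOP, monicOP_eq]
  simp

end Orthogonality

/-! ### The matrices outside and inside the contour -/

theorem cauchyTransform_neg (μ : Measure ℝ) (Q : ℂ[X]) (z : ℂ) :
    cauchyTransform μ (-Q) z = -cauchyTransform μ Q z := by
  have h := cauchyTransform_C_mul μ (-1) Q z
  rwa [C_neg, C_1, neg_one_mul, neg_one_mul] at h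

/-- The `(1,1)` entry of `Y̌_n` as a polynomial. -/
def topPoly (𝔠 : ℂ) (p : ℕ) (μ : Measure ℝ) (n : ℕ) : ℂ[X] :=
  C (𝔠 ^ ((n : ℤ) - p)) * complexOP μ n

/-- The `(2,1)` entry of `Y̌_n` as a polynomial. -/
def botPoly (𝔠 : ℂ) (p : ℕ) (μ : Measure ℝ) (n : ℕ) : ℂ[X] :=
  C (𝔠 ^ (-((n : ℤ) - p)) * opGamma μ (n - 1)) * complexOP μ (n - 1)

/-- The exterior formula for `Y̌_n`. -/
def Yext (𝔠 : ℂ) (p : ℕ) (μ : Measure ℝ) (n : ℕ) (z : ℂ) : Matrix (Fin 2) (Fin 2) ℂ :=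
  !![(topPoly 𝔠 p μ n).eval z, cauchyTransform μ (topPoly 𝔠 p μ n) z;
     (botPoly 𝔠 p μ n).eval z, cauchyTransform μ (botPoly 𝔠 p μ n) z]

theorem Yext_eq (𝔠 : ℂ) (p : ℕ) (μ : Measure ℝ) (n : ℕ) (z : ℂ) :
    Yext 𝔠 p μ n z =
      !![𝔠 ^ ((n : ℤ) - p), 0; 0, 𝔠 ^ (-((n : ℤ) - p))] * Y μ n z := by
  simp only [Yext, Y, topPoly, botPoly, cauchyTransform_C_mul, opEval_eq, opCauchy_eq, eval_mul,
    eval_C, Matrix.mul_fin_two, zero_mul, add_zero, zero_add, mul_assoc]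

theorem Ycheck_of_notMem_inside (Γ : Contour) (𝔠 : ℂ) (p : ℕ) (μ : Measure ℝ) (n : ℕ) {z : ℂ}
    (hz : z ∉ Γ.inside) : Ycheck Γ 𝔠 p μ n z = Yext 𝔠 p μ n z := by
  rw [Ycheck, Ytilde, if_neg hz, Yext_eq]

theorem Ycheck_of_mem_inside (Γ : Contour) (𝔠 : ℂ) (p : ℕ) (μ : Measure ℝ) (n : ℕ) {z : ℂ}
    (hz : z ∈ Γ.inside) :
    Ycheck Γ 𝔠 p μ n z = Yext 𝔠 p μ n z * !![1, -cauchyTransform μ 1 z; 0, 1] := by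
  rw [Ycheck, Ytilde, if_pos hz, Yext_eq, opCauchy_eq, complexOP_zero, Matrix.mul_assoc]

/-- The polynomial matrix `Y̌_n(z; ν) [0 1; 0 0] Y̌_n(z; μ)⁻¹`. -/
def jumpPoly (𝔠 : ℂ) (p : ℕ) (μ ν : Measure ℝ) (n : ℕ) : Matrix (Fin 2) (Fin 2) ℂ[X] :=
  !![-(topPoly 𝔠 p ν n * botPoly 𝔠 p μ n), topPoly 𝔠 p ν n * topPoly 𝔠 p μ n;
     -(botPoly 𝔠 p ν n * botPoly 𝔠 p μ n), botPoly 𝔠 p ν n * topPoly 𝔠 p μ n]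

theorem c0diff_eq (μ ν : Measure ℝ) (z : ℂ) :
    c0diff μ ν z = cauchyTransform μ 1 z - cauchyTransform ν 1 z := by
  rw [c0diff, opCauchy_eq, opCauchy_eq, complexOP_zero, complexOP_zero]

theorem Xmat_of_notMem_inside (Γ : Contour) {𝔠 : ℂ} {μ ν : Measure ℝ} {n : ℕ} (p : ℕ) {z : ℂ} (hz : z ∉ Γ.inside) :
    Xmat Γ 𝔠 p μ ν n z = Yext 𝔠 p ν n z * (Yext 𝔠 p μ n z)⁻¹ := by
  rw [Xmat, Ycheck_of_notMem_inside Γ 𝔠 p μ n hz, Ycheck_of_notMem_inside Γ 𝔠 p ν n hz]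

/-! ### Orthogonality relations, determinant and jump of the matrices -/

section Relations

variable {μ : Measure ℝ} [IsFiniteMeasure μ] {n : ℕ} {𝔠 : ℂ}

theorem eval_topPoly_mul_cauchyTransform_topPoly (hμ : IsCompact μ.support)
    (hn : (n : ℕ∞) ≤ μ.support.encard) (p : ℕ) (ν : Measure ℝ) {z : ℂ}
    (hz : z ∉ Complex.ofReal '' μ.support) :
    (topPoly 𝔠 p ν n).eval z * cauchyTransform μ (topPoly 𝔠 p μ n) z =
      cauchyTransform μ (topPoly 𝔠 p ν n * topPoly 𝔠 p μ n) z := by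
  have h := eval_mul_cauchyTransform_complexOP hμ hn le_rfl (natDegree_complexOP ν n).le hz
  rw [topPoly, topPoly, mul_assoc, mul_left_comm (complexOP ν n), cauchyTransform_C_mul,
    cauchyTransform_C_mul, cauchyTransform_C_mul, ← h, eval_mul, eval_C]
  ring

theorem eval_botPoly_mul_cauchyTransform_topPoly (hμ : IsCompact μ.support)
    (hn : (n : ℕ∞) ≤ μ.support.encard) (p : ℕ) (ν : Measure ℝ) {z : ℂ}
    (hz : z ∉ Complex.ofReal '' μ.support) :
    (botPoly 𝔠 p ν n).eval z * cauchyTransform μ (topPoly 𝔠 p μ n) z =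
      cauchyTransform μ (botPoly 𝔠 p ν n * topPoly 𝔠 p μ n) z := by
  have h := eval_mul_cauchyTransform_complexOP hμ hn le_rfl
    ((natDegree_complexOP ν (n - 1)).le.trans (Nat.sub_le n 1)) hz
  rw [topPoly, botPoly, mul_assoc, mul_left_comm (complexOP ν (n - 1)), cauchyTransform_C_mul,
    cauchyTransform_C_mul, cauchyTransform_C_mul, ← h, eval_mul, eval_C]
  ring

theorem eval_botPoly_mul_cauchyTransform_botPoly (hμ : IsCompact μ.support)
    (hn : (n : ℕ∞) ≤ μ.support.encard) (p : ℕ) (ν : Measure ℝ) {z : ℂ}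
    (hz : z ∉ Complex.ofReal '' μ.support) :
    (botPoly 𝔠 p ν n).eval z * cauchyTransform μ (botPoly 𝔠 p μ n) z =
      cauchyTransform μ (botPoly 𝔠 p ν n * botPoly 𝔠 p μ n) z := by
  have h := eval_mul_cauchyTransform_complexOP hμ hn (Nat.sub_le n 1)
    (natDegree_complexOP ν (n - 1)).le hz
  rw [botPoly, botPoly, mul_assoc, mul_left_comm (complexOP ν (n - 1)), cauchyTransform_C_mul,
    cauchyTransform_C_mul, cauchyTransform_C_mul, ← h, eval_mul, eval_C]
  ring

/-- Among the four products this is the only one where the polynomial outside has degree one more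
than the orthogonal polynomial inside, hence the extra 1. The powers of `𝔠` cancel. -/
theorem eval_topPoly_mul_cauchyTransform_botPoly (hμ : IsCompact μ.support)
    (hn : (n : ℕ∞) ≤ μ.support.encard) (hn1 : 1 ≤ n) (h𝔠 : 𝔠 ≠ 0) (p : ℕ) (ν : Measure ℝ) {z : ℂ}
    (hz : z ∉ Complex.ofReal '' μ.support) :
    (topPoly 𝔠 p ν n).eval z * cauchyTransform μ (botPoly 𝔠 p μ n) z =
      1 + cauchyTransform μ (topPoly 𝔠 p ν n * botPoly 𝔠 p μ n) z := by
  have h := opGamma_mul_eval_mul_cauchyTransform_complexOP_sub hμ hn (Nat.sub_lt hn1 one_pos)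
    (complexOP_monic ν n) (by rw [natDegree_complexOP]; omega) hz
  have hs : 𝔠 ^ ((n : ℤ) - p) * 𝔠 ^ (-((n : ℤ) - p)) = 1 := by
    rw [zpow_neg, mul_inv_cancel₀ (zpow_ne_zero _ h𝔠)]
  rw [topPoly, botPoly, mul_assoc, mul_left_comm (complexOP ν n), cauchyTransform_C_mul,
    cauchyTransform_C_mul, cauchyTransform_C_mul, eval_mul, eval_C]
  linear_combination h + (opGamma μ (n - 1) * ((complexOP ν n).eval z *
    cauchyTransform μ (complexOP μ (n - 1)) z -
      cauchyTransform μ (complexOP ν n * complexOP μ (n - 1)) z)) * hs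

theorem det_Yext (hμ : IsCompact μ.support) (hn : (n : ℕ∞) ≤ μ.support.encard) (hn1 : 1 ≤ n)
    (h𝔠 : 𝔠 ≠ 0) (p : ℕ) {z : ℂ} (hz : z ∉ Complex.ofReal '' μ.support) :
    (Yext 𝔠 p μ n z).det = 1 := by
  rw [Yext, Matrix.det_fin_two_of, eval_topPoly_mul_cauchyTransform_botPoly hμ hn hn1 h𝔠 p μ hz,
    mul_comm (cauchyTransform _ _ _), eval_botPoly_mul_cauchyTransform_topPoly hμ hn p μ hz,
    mul_comm (botPoly 𝔠 p μ n), add_sub_cancel_right]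

theorem inv_Yext (hμ : IsCompact μ.support) (hn : (n : ℕ∞) ≤ μ.support.encard) (hn1 : 1 ≤ n)
    (h𝔠 : 𝔠 ≠ 0) (p : ℕ) {z : ℂ} (hz : z ∉ Complex.ofReal '' μ.support) :
    (Yext 𝔠 p μ n z)⁻¹ =
      !![cauchyTransform μ (botPoly 𝔠 p μ n) z, -cauchyTransform μ (topPoly 𝔠 p μ n) z;
        -(botPoly 𝔠 p μ n).eval z, (topPoly 𝔠 p μ n).eval z] := by
  rw [Matrix.inv_def, det_Yext hμ hn hn1 h𝔠 p hz, Ring.inverse_one, one_smul, Yext,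
    Matrix.adjugate_fin_two_of]

/-- The middle factor selects the first column of `Yext` for `ν` and the second row of the inverse
for `μ`; both are polynomial. -/
theorem Yext_mul_mul_inv_Yext {ν : Measure ℝ} (hμ : IsCompact μ.support)
    (hμn : (n : ℕ∞) ≤ μ.support.encard) (hn1 : 1 ≤ n)
    (h𝔠 : 𝔠 ≠ 0) (p : ℕ) {z : ℂ} (hzμ : z ∉ Complex.ofReal '' μ.support) :
    Yext 𝔠 p ν n z * !![0, 1; 0, 0] * (Yext 𝔠 p μ n z)⁻¹ =
      (jumpPoly 𝔠 p μ ν n).map (Polynomial.eval z) := by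
  rw [inv_Yext hμ hμn hn1 h𝔠 p hzμ, Yext, Matrix.mul_fin_two, Matrix.mul_fin_two]
  ext i j
  fin_cases i <;> fin_cases j <;> simp [jumpPoly]

theorem inv_Yext_mul_Yext (hμ : IsCompact μ.support) (hμn : (n : ℕ∞) ≤ μ.support.encard)
    (hn1 : 1 ≤ n) (h𝔠 : 𝔠 ≠ 0) (p : ℕ) {z : ℂ} (hzμ : z ∉ Complex.ofReal '' μ.support) :
    (Yext 𝔠 p μ n z)⁻¹ * Yext 𝔠 p μ n z = 1 :=
  Matrix.nonsing_inv_mul _ (by rw [det_Yext hμ hμn hn1 h𝔠 p hzμ]; exact isUnit_one)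

theorem Mmat_eq (Γ : Contour) (hΓ : Γ.Encircles μ) (hμ : IsCompact μ.support)
    (hμn : (n : ℕ∞) ≤ μ.support.encard)
    (hn1 : 1 ≤ n) (h𝔠 : 𝔠 ≠ 0) (p : ℕ) {w : ℂ} (hw : w ∈ Γ.trace) :
    Mmat Γ 𝔠 p μ n w = (jumpPoly 𝔠 p μ μ n).map (Polynomial.eval w) := by
  rw [Mmat, Ycheck_of_notMem_inside Γ 𝔠 p μ n (fun h => h.1 hw),
    Yext_mul_mul_inv_Yext hμ hμn hn1 h𝔠 p (Γ.notMem_trace_of_encircles hΓ hw)]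

theorem Yext_mul_inv_Yext_mul_Mmat {ν : Measure ℝ} (Γ : Contour) (hΓ : Γ.Encircles μ) (hμ : IsCompact μ.support)
    (hμn : (n : ℕ∞) ≤ μ.support.encard)
    (hn1 : 1 ≤ n) (h𝔠 : 𝔠 ≠ 0) (p : ℕ) {w : ℂ} (hw : w ∈ Γ.trace) :
    Yext 𝔠 p ν n w * (Yext 𝔠 p μ n w)⁻¹ * Mmat Γ 𝔠 p μ n w =
      (jumpPoly 𝔠 p μ ν n).map (Polynomial.eval w) := by
  have hwμ := Γ.notMem_trace_of_encircles hΓ hw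
  rw [Mmat, Ycheck_of_notMem_inside Γ 𝔠 p μ n (fun h => h.1 hw), Matrix.mul_assoc (Yext 𝔠 p ν n w),
    ← Matrix.mul_assoc (Yext 𝔠 p μ n w)⁻¹, ← Matrix.mul_assoc (Yext 𝔠 p μ n w)⁻¹,
    inv_Yext_mul_Yext hμ hμn hn1 h𝔠 p hwμ, Matrix.one_mul, ← Matrix.mul_assoc,
    Yext_mul_mul_inv_Yext hμ hμn hn1 h𝔠 p hwμ]

/-- The two unipotent factors that modify `Y_n` inside `Γ` combine to `I + c₀(μ - ν) E`, with `E =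
[0 1; 0 0]`. -/
theorem Xmat_of_mem_inside {ν : Measure ℝ} (Γ : Contour) (hμ : IsCompact μ.support)
    (hμn : (n : ℕ∞) ≤ μ.support.encard) (hn1 : 1 ≤ n) (h𝔠 : 𝔠 ≠ 0) (p : ℕ) {z : ℂ}
    (hz : z ∈ Γ.inside) (hzμ : z ∉ Complex.ofReal '' μ.support) :
    Xmat Γ 𝔠 p μ ν n z = Yext 𝔠 p ν n z * (Yext 𝔠 p μ n z)⁻¹ +
      c0diff μ ν z • (jumpPoly 𝔠 p μ ν n).map (Polynomial.eval z) := by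
  have hU : (!![1, -cauchyTransform μ 1 z; 0, 1] : Matrix (Fin 2) (Fin 2) ℂ)⁻¹ =
      !![1, cauchyTransform μ 1 z; 0, 1] := by
    rw [Matrix.inv_def, Matrix.det_fin_two_of, Matrix.adjugate_fin_two_of]
    simp
  have hUU : (!![1, -cauchyTransform ν 1 z; 0, 1] * !![1, cauchyTransform μ 1 z; 0, 1] :
      Matrix (Fin 2) (Fin 2) ℂ) = 1 + c0diff μ ν z • !![0, 1; 0, 0] := by
    rw [c0diff_eq, Matrix.mul_fin_two, Matrix.one_fin_two]
    ext i j
    fin_cases i <;> fin_cases j <;> simp [sub_eq_add_neg]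
  rw [Xmat, Ycheck_of_mem_inside Γ 𝔠 p μ n hz, Ycheck_of_mem_inside Γ 𝔠 p ν n hz,
    Matrix.mul_inv_rev, hU, Matrix.mul_assoc, ← Matrix.mul_assoc (!![1, _; 0, 1]), hUU,
    ← Matrix.mul_assoc, Matrix.mul_add, Matrix.mul_one, Matrix.mul_smul, Matrix.add_mul,
    Matrix.smul_mul, Yext_mul_mul_inv_Yext hμ hμn hn1 h𝔠 p hzμ]

end Relations

/-! ### The analytic continuation of the quotient -/

section TwoMeasures

variable {μ ν : Measure ℝ} [IsFiniteMeasure μ] [IsFiniteMeasure ν] {n : ℕ} {𝔠 : ℂ}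

/-- Each entry is a difference of two products of a polynomial and a Cauchy transform, one for each
measure. The orthogonality relations turn both into Cauchy transforms of the same polynomial, and
the extra 1 appears exactly on the diagonal. -/
theorem Yext_mul_inv_Yext (hμ : IsCompact μ.support) (hν : IsCompact ν.support)
    (hμn : (n : ℕ∞) ≤ μ.support.encard) (hνn : (n : ℕ∞) ≤ ν.support.encard) (hn1 : 1 ≤ n)
    (h𝔠 : 𝔠 ≠ 0) (p : ℕ) {z : ℂ} (hzμ : z ∉ Complex.ofReal '' μ.support)
    (hzν : z ∉ Complex.ofReal '' ν.support) :
    Yext 𝔠 p ν n z * (Yext 𝔠 p μ n z)⁻¹ = 1 + Matrix.of fun i j =>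
      cauchyTransform ν (jumpPoly 𝔠 p μ ν n i j) z -
        cauchyTransform μ (jumpPoly 𝔠 p μ ν n i j) z := by
  rw [inv_Yext hμ hμn hn1 h𝔠 p hzμ, Yext, Matrix.mul_fin_two]
  have m11 := eval_topPoly_mul_cauchyTransform_topPoly (𝔠 := 𝔠) hμ hμn p ν hzμ
  have m21 := eval_botPoly_mul_cauchyTransform_topPoly (𝔠 := 𝔠) hμ hμn p ν hzμ
  have m22 := eval_botPoly_mul_cauchyTransform_botPoly (𝔠 := 𝔠) hμ hμn p ν hzμ
  have m12 := eval_topPoly_mul_cauchyTransform_botPoly hμ hμn hn1 h𝔠 p ν hzμ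
  have n11 := eval_topPoly_mul_cauchyTransform_topPoly (𝔠 := 𝔠) hν hνn p μ hzν
  have n21 := eval_botPoly_mul_cauchyTransform_topPoly (𝔠 := 𝔠) hν hνn p μ hzν
  have n22 := eval_botPoly_mul_cauchyTransform_botPoly (𝔠 := 𝔠) hν hνn p μ hzν
  have n12 := eval_topPoly_mul_cauchyTransform_botPoly hν hνn hn1 h𝔠 p μ hzν
  rw [mul_comm (topPoly 𝔠 p μ n) (topPoly 𝔠 p ν n)] at n11
  rw [mul_comm (botPoly 𝔠 p μ n) (topPoly 𝔠 p ν n)] at n21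
  rw [mul_comm (botPoly 𝔠 p μ n) (botPoly 𝔠 p ν n)] at n22
  rw [mul_comm (topPoly 𝔠 p μ n) (botPoly 𝔠 p ν n)] at n12
  ext i j
  fin_cases i <;> fin_cases j <;> simp [jumpPoly, cauchyTransform_neg]
  · linear_combination m12 - n21
  · linear_combination n11 - m11
  · linear_combination m22 - n22
  · linear_combination n12 - m21

theorem Contour.cauchy_c0diff_mul_eval (Γ : Contour) (hμ : IsCompact μ.support)
    (hν : IsCompact ν.support) (hΓμ : Γ.Encircles μ) (hΓν : Γ.Encircles ν) (P : ℂ[X]) {z : ℂ}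
    (hz : z ∉ Γ.trace) (hzμ : z ∉ Complex.ofReal '' μ.support)
    (hzν : z ∉ Complex.ofReal '' ν.support) :
    Γ.cauchy (fun w => c0diff μ ν w * P.eval w) z =
      windingNumber Γ.param z * (c0diff μ ν z * P.eval z) +
        (cauchyTransform ν P z - cauchyTransform μ P z) := by
  have e : (fun w => c0diff μ ν w * P.eval w) = fun w =>
      P.eval w * cauchyTransform μ 1 w - P.eval w * cauchyTransform ν 1 w := by
    ext w
    rw [c0diff_eq]
    ring
  rw [e, Γ.cauchy_sub (f := fun w => P.eval w * cauchyTransform μ 1 w)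
    (g := fun w => P.eval w * cauchyTransform ν 1 w)
    (P.continuous.continuousOn.mul (Γ.continuousOn_cauchyTransform hμ hΓμ 1))
    (P.continuous.continuousOn.mul (Γ.continuousOn_cauchyTransform hν hΓν 1)) hz,
    Γ.cauchy_eval_mul_cauchyTransform_one hμ hΓμ P hz hzμ,
    Γ.cauchy_eval_mul_cauchyTransform_one hν hΓν P hz hzν, c0diff_eq]
  ring

/-- The continuation of `X_n(·; μ, ν)`, as `I` plus the Cauchy integral of its jump. -/
def Xcont (Γ : Contour) (𝔠 : ℂ) (p : ℕ) (μ ν : Measure ℝ) (n : ℕ) (z : ℂ) :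
    Matrix (Fin 2) (Fin 2) ℂ :=
  1 + Γ.cauchyMatrix (fun w => c0diff μ ν w • (jumpPoly 𝔠 p μ ν n).map (Polynomial.eval w)) z

theorem Contour.continuousOn_c0diff (Γ : Contour) (hμ : IsCompact μ.support)
    (hν : IsCompact ν.support) (hΓμ : Γ.Encircles μ) (hΓν : Γ.Encircles ν) :
    ContinuousOn (c0diff μ ν) Γ.trace :=
  ((Γ.continuousOn_cauchyTransform hμ hΓμ 1).sub (Γ.continuousOn_cauchyTransform hν hΓν 1)).congr
    fun z _ => c0diff_eq μ ν z

theorem differentiableOn_Xcont (Γ : Contour) (hμ : IsCompact μ.support)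
    (hν : IsCompact ν.support) (hΓμ : Γ.Encircles μ) (hΓν : Γ.Encircles ν) (p : ℕ) (i j : Fin 2) :
    DifferentiableOn ℂ (fun z => Xcont Γ 𝔠 p μ ν n z i j) Γ.traceᶜ := by
  have h := Γ.differentiableOn_cauchy (f := fun w =>
    c0diff μ ν w * (jumpPoly 𝔠 p μ ν n i j).eval w)
    ((Γ.continuousOn_c0diff hμ hν hΓμ hΓν).mul (Polynomial.continuous _).continuousOn)
  exact h.const_add ((1 : Matrix (Fin 2) (Fin 2) ℂ) i j)

/-- The winding number switches the term `c₀(μ - ν) P` on inside and off outside, exactly as the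
modification of `Y_n` does. -/
theorem Xcont_eq_Xmat (Γ : Contour) (hμ : IsCompact μ.support)
    (hν : IsCompact ν.support) (hΓμ : Γ.Encircles μ) (hΓν : Γ.Encircles ν)
    (hμn : (n : ℕ∞) ≤ μ.support.encard) (hνn : (n : ℕ∞) ≤ ν.support.encard) (hn1 : 1 ≤ n)
    (h𝔠 : 𝔠 ≠ 0) (p : ℕ) {z : ℂ} (hz : z ∉ Γ.trace)
    (hzμ : z ∉ Complex.ofReal '' μ.support) (hzν : z ∉ Complex.ofReal '' ν.support) :
    Xcont Γ 𝔠 p μ ν n z = Xmat Γ 𝔠 p μ ν n z := by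
  have hentry : ∀ i j, Xcont Γ 𝔠 p μ ν n z i j = (1 : Matrix (Fin 2) (Fin 2) ℂ) i j +
      (windingNumber Γ.param z * (c0diff μ ν z * (jumpPoly 𝔠 p μ ν n i j).eval z) +
        (cauchyTransform ν (jumpPoly 𝔠 p μ ν n i j) z -
          cauchyTransform μ (jumpPoly 𝔠 p μ ν n i j) z)) := fun i j =>
    congrArg ((1 : Matrix (Fin 2) (Fin 2) ℂ) i j + ·) (Γ.cauchy_c0diff_mul_eval hμ hν hΓμ hΓν (jumpPoly 𝔠 p μ ν n i j) hz hzμ hzν)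
  ext i j
  rw [hentry]
  rcases Γ.inside_or_outside hz with h | h
  · rw [Xmat_of_mem_inside Γ hμ hμn hn1 h𝔠 p h hzμ,
      Yext_mul_inv_Yext hμ hν hμn hνn hn1 h𝔠 p hzμ hzν, h.2]
    simp only [Matrix.add_apply, Matrix.smul_apply, Matrix.of_apply, Matrix.map_apply, smul_eq_mul]
    ring
  · rw [Xmat_of_notMem_inside Γ p (fun h' => one_ne_zero (h'.2.symm.trans h.2)),
      Yext_mul_inv_Yext hμ hν hμn hνn hn1 h𝔠 p hzμ hzν, h.2]
    simp only [Matrix.add_apply, Matrix.of_apply]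
    ring

end TwoMeasures

/-! ### Estimates in `L²` of the contour -/

/-- Used with `a = 1` for the full density `f = D + u D` and with `a = 0` for the remainder `u D`.
-/
theorem eLpNorm_two_toReal_le {α : Type*} [MeasurableSpace α] {m : Measure α} [IsFiniteMeasure m]
    {f g h : α → ℂ} (hg : MemLp g 2 m) (hh : MemLp h 2 m) {ε a : ℝ} (hε : 0 ≤ ε) (ha : 0 ≤ a)
    (hf : ∀ᵐ x ∂m, ‖f x‖ ≤ ε * (a + ‖g x‖ + ‖h x‖)) :
    (eLpNorm f 2 m).toReal ≤
      ε * (a * √(m.real Set.univ) + (eLpNorm g 2 m).toReal + (eLpNorm h 2 m).toReal) := by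
  have hc : MemLp (fun _ : α => a) 2 m := memLp_const a
  have hgn := hg.norm
  have hhn := hh.norm
  have h1 : eLpNorm f 2 m ≤ ENNReal.ofReal ε *
      (eLpNorm (fun _ : α => a) 2 m + eLpNorm g 2 m + eLpNorm h 2 m) := by
    refine (eLpNorm_mono_ae_real hf).trans ?_
    change eLpNorm (fun x => ε • ((fun _ => a) x + ‖g x‖ + ‖h x‖)) 2 m ≤ _
    refine (eLpNorm_const_smul ε (fun x => (fun _ => a) x + ‖g x‖ + ‖h x‖) 2 m).le.trans ?_
    rw [Real.enorm_eq_ofReal hε, ← eLpNorm_norm g, ← eLpNorm_norm h]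
    gcongr
    refine (eLpNorm_add_le (hc.add hgn).1 hhn.1 one_le_two).trans ?_
    gcongr
    exact eLpNorm_add_le hc.1 hgn.1 one_le_two
  have hfin : eLpNorm (fun _ : α => a) 2 m + eLpNorm g 2 m + eLpNorm h 2 m ≠ ⊤ := by
    simp [hc.2.ne, hg.2.ne, hh.2.ne]
  have h2 := ENNReal.toReal_mono (ENNReal.mul_ne_top ENNReal.ofReal_ne_top hfin) h1
  rw [ENNReal.toReal_mul, ENNReal.toReal_ofReal hε, ENNReal.toReal_add (by simp [hc.2.ne, hg.2.ne])
    hh.2.ne, ENNReal.toReal_add hc.2.ne hg.2.ne] at h2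
  have h3 : (eLpNorm (fun _ : α => a) 2 m).toReal = a * √(m.real Set.univ) := by
    rw [eLpNorm_const' a two_ne_zero ENNReal.ofNat_ne_top, ENNReal.toReal_mul,
      Real.enorm_eq_ofReal ha, ENNReal.toReal_ofReal ha, ← ENNReal.toReal_rpow, Real.sqrt_eq_rpow,
      Measure.real]
    norm_num
  rwa [h3] at h2

theorem eLpNorm_one_toReal_le {α : Type*} [MeasurableSpace α] {m : Measure α} [IsFiniteMeasure m]
    {f : α → ℂ} (hf : MemLp f 2 m) :
    (eLpNorm f 1 m).toReal ≤ √(m.real Set.univ) * (eLpNorm f 2 m).toReal := by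
  have h := eLpNorm_le_eLpNorm_mul_rpow_measure_univ (one_le_two (α := ENNReal)) hf.1
  have h2 := ENNReal.toReal_mono (ENNReal.mul_ne_top hf.2.ne
    (ENNReal.rpow_ne_top_of_nonneg (by norm_num) (measure_ne_top m _))) h
  rw [ENNReal.toReal_mul, ← ENNReal.toReal_rpow] at h2
  rw [Real.sqrt_eq_rpow, mul_comm, Measure.real]
  norm_num at h2 ⊢
  exact h2

/-! ### Arc length measure and the size of the contour -/

namespace Contour

variable (Γ : Contour)

theorem aemeasurable_param :
    AEMeasurable Γ.param (volume.restrict (Set.Icc (0 : ℝ) 1)) :=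
  Γ.piecewiseSmooth.1.aemeasurable measurableSet_Icc

theorem aemeasurable_param_withDensity : AEMeasurable Γ.param
    ((volume.restrict (Set.Icc (0 : ℝ) 1)).withDensity fun t => ‖deriv Γ.param t‖ₑ) :=
  Γ.aemeasurable_param.mono_ac (withDensity_absolutelyContinuous _ _)

theorem ae_mem_trace : ∀ᵐ w ∂Γ.arcLength, w ∈ Γ.trace := by
  refine (ae_map_iff Γ.aemeasurable_param_withDensity
    Γ.isCompact_trace.isClosed.measurableSet).2 ?_
  refine (withDensity_absolutelyContinuous _ _).ae_le ?_
  exact (ae_restrict_iff' measurableSet_Icc).2 (Eventually.of_forall fun t ht =>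
    Γ.param_mem_trace ht)

theorem aestronglyMeasurable_of_continuousOn {f : ℂ → ℂ} (hf : ContinuousOn f Γ.trace) :
    AEStronglyMeasurable f Γ.arcLength := by
  rw [← Measure.restrict_eq_self_of_ae_mem Γ.ae_mem_trace]
  exact hf.aestronglyMeasurable Γ.isCompact_trace.isClosed.measurableSet

theorem eLpNorm_one_toReal_eq {f : ℂ → ℂ} (hf : ContinuousOn f Γ.trace) :
    (eLpNorm f 1 Γ.arcLength).toReal =
      ∫ t in (0 : ℝ)..1, ‖f (Γ.param t) * deriv Γ.param t‖ := by
  have hm := Γ.aestronglyMeasurable_of_continuousOn hf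
  have hint := Γ.intervalIntegrable_mul_deriv hf
  rw [intervalIntegrable_iff_integrableOn_Icc_of_le zero_le_one] at hint
  rw [intervalIntegral.integral_of_le zero_le_one, ← integral_Icc_eq_integral_Ioc,
    integral_norm_eq_lintegral_enorm hint.aestronglyMeasurable, eLpNorm_one_eq_lintegral_enorm]
  rw [arcLength] at hm ⊢
  rw [lintegral_map' hm.enorm Γ.aemeasurable_param_withDensity,
    lintegral_withDensity_eq_lintegral_mul₀' (g := fun t => ‖f (Γ.param t)‖ₑ)
      (measurable_deriv Γ.param).enorm.aemeasurable
      (hm.comp_aemeasurable Γ.aemeasurable_param_withDensity).enorm]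
  congr 1
  refine lintegral_congr fun t => ?_
  rw [enorm_mul, Pi.mul_apply, mul_comm]

theorem arcLength_univ_toReal : (Γ.arcLength Set.univ).toReal = Γ.length := by
  have h := Γ.eLpNorm_one_toReal_eq (f := fun _ => 1) continuousOn_const
  simp only [one_mul] at h
  rw [length, ← h, eLpNorm_one_eq_lintegral_enorm]
  simp

instance isFiniteMeasure_arcLength : IsFiniteMeasure Γ.arcLength := by
  refine ⟨?_⟩
  rw [arcLength, Measure.map_apply_of_aemeasurable Γ.aemeasurable_param_withDensity
    MeasurableSet.univ, Set.preimage_univ, withDensity_apply _ MeasurableSet.univ,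
    Measure.restrict_univ]
  have h := Γ.piecewiseSmooth.intervalIntegrable_deriv
  rw [intervalIntegrable_iff_integrableOn_Icc_of_le zero_le_one] at h
  exact h.2

theorem length_nonneg : 0 ≤ Γ.length := by
  rw [← Γ.arcLength_univ_toReal]
  exact ENNReal.toReal_nonneg

theorem memLp_of_continuousOn {f : ℂ → ℂ} (hf : ContinuousOn f Γ.trace) (p : ENNReal) :
    MemLp f p Γ.arcLength := by
  obtain ⟨B, hB⟩ := Γ.isCompact_trace.exists_bound_of_continuousOn hf
  refine MemLp.of_bound (Γ.aestronglyMeasurable_of_continuousOn hf) B ?_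
  filter_upwards [Γ.ae_mem_trace] with w hw using hB w hw

theorem norm_cauchy_le {f : ℂ → ℂ} (hf : ContinuousOn f Γ.trace) {z : ℂ} (hz : z ∉ Γ.trace) :
    ‖Γ.cauchy f z‖ ≤
      (2 * Real.pi * Metric.infDist z Γ.trace)⁻¹ * (eLpNorm f 1 Γ.arcLength).toReal := by
  have hd : 0 < Metric.infDist z Γ.trace :=
    (Γ.isCompact_trace.isClosed.notMem_iff_infDist_pos Γ.nonempty_trace).1 hz
  have hπ := Real.pi_pos
  rw [Γ.eLpNorm_one_toReal_eq hf, cauchy, cauchyAlong, norm_mul]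
  have h1 : ‖(2 * Real.pi * Complex.I : ℂ)⁻¹‖ = (2 * Real.pi)⁻¹ := by
    simp [abs_of_pos hπ]
  rw [h1, mul_inv (2 * Real.pi), mul_assoc, ← intervalIntegral.integral_const_mul]
  gcongr
  refine intervalIntegral.norm_integral_le_of_norm_le zero_le_one
    (Eventually.of_forall fun t ht => ?_)
    ((Γ.intervalIntegrable_mul_deriv hf).norm.const_mul _)
  have h2 : Metric.infDist z Γ.trace ≤ ‖Γ.param t - z‖ := by
    rw [← dist_eq_norm, dist_comm]
    exact Metric.infDist_le_dist_of_mem (Γ.param_mem_trace (Set.Ioc_subset_Icc_self ht))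
  rw [norm_mul, norm_div, norm_mul, ← mul_assoc, ← div_eq_inv_mul]
  gcongr

/-- The winding number 1 is itself a Cauchy integral, so it is bounded by the length over `2π` times
the distance. -/
theorem two_pi_mul_infDist_le_length {z : ℂ} (hz : z ∈ Γ.inside) :
    2 * Real.pi * Metric.infDist z Γ.trace ≤ Γ.length := by
  have hd : 0 < Metric.infDist z Γ.trace :=
    (Γ.isCompact_trace.isClosed.notMem_iff_infDist_pos Γ.nonempty_trace).1 hz.1
  have hπ := Real.pi_pos
  have h := Γ.norm_cauchy_le (f := fun _ => 1) continuousOn_const hz.1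
  have h1 : Γ.cauchy (fun _ => 1) z = 1 := hz.2
  have h2 : (eLpNorm (fun _ : ℂ => (1 : ℂ)) 1 Γ.arcLength).toReal = Γ.length := by
    rw [← Γ.arcLength_univ_toReal, eLpNorm_one_eq_lintegral_enorm]
    simp
  rwa [h1, norm_one, h2, ← div_eq_inv_mul, one_le_div (by positivity)] at h

theorem dist_le_length {z w : ℂ} (hz : z ∈ Γ.trace) (hw : w ∈ Γ.trace) :
    dist z w ≤ Γ.length := by
  obtain ⟨s, hs, rfl⟩ := hz
  obtain ⟨t, ht, rfl⟩ := hw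
  wlog hst : s ≤ t generalizing s t
  · rw [dist_comm]
    exact this t ht s hs (not_le.1 hst).le
  obtain ⟨e, he, hd⟩ := Γ.piecewiseSmooth.exists_countable_hasDerivAt
  have hint := Γ.piecewiseSmooth.intervalIntegrable_deriv
  have hsub : Set.uIcc s t ⊆ Set.uIcc (0 : ℝ) 1 := by
    rw [Set.uIcc_of_le hst, Set.uIcc_of_le zero_le_one]
    exact Set.Icc_subset_Icc hs.1 ht.2
  have h := MeasureTheory.integral_eq_of_hasDerivAt_off_countable_of_le Γ.param (deriv Γ.param) hst he
    (Γ.piecewiseSmooth.1.mono (Set.Icc_subset_Icc hs.1 ht.2))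
    (fun x hx => hd x ⟨⟨hs.1.trans_lt hx.1.1, hx.1.2.trans_le ht.2⟩, hx.2⟩) (hint.mono_set hsub)
  rw [dist_comm, dist_eq_norm, ← h, length]
  refine (intervalIntegral.norm_integral_le_integral_norm hst).trans ?_
  exact intervalIntegral.integral_mono_interval hs.1 hst ht.2
    (Eventually.of_forall fun x => norm_nonneg _) hint.norm

/-- The nearest point of the curve is within one length of `z`, and any two points of the curve are
within another length of each other. -/
theorem norm_le_of_mem_trace {R : ℝ} {z : ℂ} (hz : z ∈ Γ.inside) (hzR : ‖z‖ ≤ R) {w : ℂ}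
    (hw : w ∈ Γ.trace) : ‖w‖ ≤ R + 2 * Γ.length := by
  obtain ⟨y, hy, hzy⟩ := Γ.isCompact_trace.exists_infDist_eq_dist Γ.nonempty_trace z
  have h1 := Γ.two_pi_mul_infDist_le_length hz
  rw [hzy] at h1
  have h2 : dist z y ≤ Γ.length := by
    nlinarith [Real.pi_gt_three, dist_nonneg (x := z) (y := y)]
  have h3 := Γ.dist_le_length hw hy
  have h4 := dist_triangle w y 0
  have h5 := dist_triangle y z 0
  rw [dist_comm y z] at h5
  simp only [dist_zero_right] at h4 h5
  linarith

theorem isCompact_support_of_encircles {μ : Measure ℝ} (h : Γ.Encircles μ) :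
    IsCompact μ.support := by
  obtain ⟨B, hB⟩ := Γ.isCompact_trace.isBounded.exists_norm_le
  refine Metric.isCompact_of_isClosed_isBounded Measure.isClosed_support
    ((Metric.isBounded_closedBall (x := 0) (r := B + Γ.length)).subset fun x hx => ?_)
  obtain ⟨y, hy, hxy⟩ := Γ.isCompact_trace.exists_infDist_eq_dist Γ.nonempty_trace (x : ℂ)
  have h1 := Γ.two_pi_mul_infDist_le_length (h x hx)
  rw [hxy] at h1
  have h2 : dist (x : ℂ) y ≤ Γ.length := by
    nlinarith [Real.pi_gt_three, dist_nonneg (x := (x : ℂ)) (y := y)]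
  have h3 := dist_triangle (x : ℂ) y 0
  have h4 := hB y hy
  simp only [dist_zero_right, Complex.norm_real] at h3
  rw [mem_closedBall_zero_iff]
  linarith

end Contour

/-! ### The small-norm argument -/

/-- If the exterior values continue continuously to the curve, the limits exist at every point and
in every approach region, so no theory of singular integrals is involved. -/
theorem Contour.isExteriorBoundaryValue_of_eqOn (Γ : Contour) {f g : ℂ → ℂ}
    (hg : ∀ x ∈ Γ.trace, ContinuousAt g x) (h : Set.EqOn (Γ.cauchy f) g Γ.outside) :
    Γ.IsExteriorBoundaryValue f g := by
  filter_upwards [Γ.ae_mem_trace] with x hx α _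
  refine ((hg x hx).tendsto.mono_left nhdsWithin_le_nhds).congr' ?_
  filter_upwards [self_mem_nhdsWithin] with z hz using (h hz.1).symm

theorem Contour.ae_norm_le_linftyNorm (Γ : Contour) {F : ℂ → Matrix (Fin 2) (Fin 2) ℂ}
    (hF : ∀ i j, ContinuousOn (fun w => F w i j) Γ.trace) :
    ∀ᵐ w ∂Γ.arcLength, ∀ i j, ‖F w i j‖ ≤ Γ.linftyNorm F := by
  have hbd : ∃ B : ℝ, ∀ w ∈ Γ.trace, ‖F w‖ ≤ B := by
    choose B hB using fun i j => Γ.isCompact_trace.exists_bound_of_continuousOn (hF i j)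
    refine ⟨∑ i, ∑ j, |B i j|, fun w hw => ?_⟩
    refine (Matrix.norm_le_iff (by positivity)).2 fun i j => ?_
    calc ‖F w i j‖ ≤ |B i j| := (hB i j w hw).trans (le_abs_self _)
      _ ≤ ∑ j, |B i j| := Finset.single_le_sum (f := fun j => |B i j|)
          (fun _ _ => abs_nonneg _) (Finset.mem_univ j)
      _ ≤ ∑ i, ∑ j, |B i j| := Finset.single_le_sum (f := fun i => ∑ j, |B i j|)
          (fun _ _ => Finset.sum_nonneg fun _ _ => abs_nonneg _) (Finset.mem_univ i)
  obtain ⟨B, hB⟩ := hbd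
  -- Without finiteness `linftyNorm` would be the default value 0 and bound nothing.
  have hfin : eLpNormEssSup F Γ.arcLength ≠ ⊤ := by
    refine (eLpNormEssSup_lt_top_of_ae_bound (C := B) ?_).ne
    filter_upwards [Γ.ae_mem_trace] with w hw using hB w hw
  filter_upwards [ae_le_eLpNormEssSup (f := F) (μ := Γ.arcLength)] with w hw i j
  refine (Matrix.norm_entry_le_entrywise_sup_norm (F w)).trans ?_
  have h := ENNReal.toReal_mono hfin hw
  rwa [toReal_enorm] at h

section SmallNorm

variable {μ ν : Measure ℝ} [IsFiniteMeasure μ] [IsFiniteMeasure ν] {n : ℕ} {𝔠 : ℂ}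

/-- An a priori estimate suffices: the solution is already explicit, so no operator has to be
inverted. The bound on `𝒞⁻_Γ` is applied only to the entries of `f`, whose boundary values `u` are
known. -/
theorem norm_Xcont_sub_le (Γ : Contour) (hΓμ : Γ.Encircles μ) (hΓν : Γ.Encircles ν)
    (hμn : (n : ℕ∞) ≤ μ.support.encard) (hνn : (n : ℕ∞) ≤ ν.support.encard) (hn1 : 1 ≤ n)
    (h𝔠 : 𝔠 ≠ 0) (p : ℕ) {Cb : NNReal} (hC : Γ.ExteriorCauchyBound Cb)
    (hsmall : Cb * Γ.linftyNorm (fun w => Jmat Γ 𝔠 p μ ν n w - 1) ≤ 1 / 4)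
    {z : ℂ} (hz : z ∉ Γ.trace) :
    ‖Xcont Γ 𝔠 p μ ν n z -
      (1 + Γ.cauchyMatrix (fun w => c0diff μ ν w • Mmat Γ 𝔠 p μ n w) z)‖ ≤
      Cb * Γ.linftyNorm (fun w => Jmat Γ 𝔠 p μ ν n w - 1) ^ 2 * Γ.length /
        Metric.infDist z Γ.trace := by
  have hμ := Γ.isCompact_support_of_encircles hΓμ
  have hν := Γ.isCompact_support_of_encircles hΓν
  set ε := Γ.linftyNorm (fun w => Jmat Γ 𝔠 p μ ν n w - 1) with hεdef
  have hε : 0 ≤ ε := ENNReal.toReal_nonneg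
  have hd : 0 < Metric.infDist z Γ.trace :=
    (Γ.isCompact_trace.isClosed.notMem_iff_infDist_pos Γ.nonempty_trace).1 hz
  set P := jumpPoly 𝔠 p μ ν n with hP
  let u : Fin 2 → Fin 2 → ℂ → ℂ := fun i j w =>
    cauchyTransform ν (P i j) w - cauchyTransform μ (P i j) w
  let f : Fin 2 → Fin 2 → ℂ → ℂ := fun i j w => c0diff μ ν w * (P i j).eval w
  let D : Fin 2 → Fin 2 → ℂ → ℂ := fun i j w =>
    c0diff μ ν w * (jumpPoly 𝔠 p μ μ n i j).eval w
  have hc0 := Γ.continuousOn_c0diff hμ hν hΓμ hΓν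
  have hfc : ∀ i j, ContinuousOn (f i j) Γ.trace := fun i j =>
    hc0.mul (Polynomial.continuous _).continuousOn
  have hDc : ∀ i j, ContinuousOn (D i j) Γ.trace := fun i j =>
    hc0.mul (Polynomial.continuous _).continuousOn
  have huc : ∀ i j, ContinuousOn (u i j) Γ.trace := fun i j =>
    (Γ.continuousOn_cauchyTransform hν hΓν _).sub (Γ.continuousOn_cauchyTransform hμ hΓμ _)
  have hM : ∀ w ∈ Γ.trace, ∀ i j, (c0diff μ ν w • Mmat Γ 𝔠 p μ n w) i j = D i j w := by
    intro w hw i j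
    rw [Mmat_eq Γ hΓμ hμ hμn hn1 h𝔠 p hw]
    rfl
  have hJ : ∀ w, Jmat Γ 𝔠 p μ ν n w - 1 = c0diff μ ν w • Mmat Γ 𝔠 p μ n w := fun w => by
    rw [Jmat, add_sub_cancel_left]
  have hDε : ∀ᵐ w ∂Γ.arcLength, ∀ i j, ‖D i j w‖ ≤ ε := by
    have h := Γ.ae_norm_le_linftyNorm (F := fun w => Jmat Γ 𝔠 p μ ν n w - 1) fun i j =>
      (hDc i j).congr fun w hw => by
        rw [hJ, hM w hw]
    filter_upwards [h, Γ.ae_mem_trace] with w hw hwt i j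
    have := hw i j
    rwa [hJ, hM w hwt] at this
  -- The identity `P = (I + u) M_n`, multiplied by `c₀(μ - ν)`.
  have hfu : ∀ w ∈ Γ.trace, ∀ i j, f i j w = D i j w + (u i 0 w * D 0 j w + u i 1 w * D 1 j w) := by
    intro w hw i j
    have h1 := Yext_mul_inv_Yext_mul_Mmat (ν := ν) Γ hΓμ hμ hμn hn1 h𝔠 p hw
    rw [Yext_mul_inv_Yext hμ hν hμn hνn hn1 h𝔠 p (Γ.notMem_trace_of_encircles hΓμ hw)
      (Γ.notMem_trace_of_encircles hΓν hw), Matrix.add_mul, Matrix.one_mul,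
      Mmat_eq Γ hΓμ hμ hμn hn1 h𝔠 p hw] at h1
    have h2 := congrFun (congrFun h1 i) j
    simp only [Matrix.add_apply, Matrix.mul_apply, Fin.sum_univ_two, Matrix.of_apply,
      Matrix.map_apply] at h2
    simp only [f, D, u, hP]
    rw [← h2]
    ring
  have hbv : ∀ i j, Γ.IsExteriorBoundaryValue (f i j) (u i j) := by
    intro i j
    refine Γ.isExteriorBoundaryValue_of_eqOn (fun x hx => ?_) fun w hw => ?_
    · exact ((differentiableOn_cauchyTransform hν _).continuousOn.continuousAt
        ((isCompact_ofReal_support hν).isClosed.isOpen_compl.mem_nhds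
          (Γ.notMem_trace_of_encircles hΓν hx))).sub
        ((differentiableOn_cauchyTransform hμ _).continuousOn.continuousAt
        ((isCompact_ofReal_support hμ).isClosed.isOpen_compl.mem_nhds
          (Γ.notMem_trace_of_encircles hΓμ hx)))
    · have h := Γ.cauchy_c0diff_mul_eval hμ hν hΓμ hΓν (P i j) hw.1
        (Γ.notMem_support_of_outside hΓμ hw) (Γ.notMem_support_of_outside hΓν hw)
      rw [hw.2, zero_mul, zero_add] at h
      exact h
  have hfL := fun i j => Γ.memLp_of_continuousOn (hfc i j) 2
  have huL := fun i j => Γ.memLp_of_continuousOn (huc i j) 2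
  have hCb : ∀ i j, (eLpNorm (u i j) 2 Γ.arcLength).toReal ≤
      Cb * (eLpNorm (f i j) 2 Γ.arcLength).toReal := by
    intro i j
    have h := ENNReal.toReal_mono (ENNReal.mul_ne_top ENNReal.coe_ne_top (hfL i j).2.ne)
      (hC _ _ (hfL i j) (hbv i j))
    rwa [ENNReal.toReal_mul, ENNReal.coe_toReal] at h
  set s := √(Γ.arcLength.real Set.univ) with hs
  have hs2 : s * s = Γ.length := by
    rw [hs, Real.mul_self_sqrt measureReal_nonneg]
    exact Γ.arcLength_univ_toReal
  have hs0 : 0 ≤ s := Real.sqrt_nonneg _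
  have hfn : ∀ i j, (eLpNorm (f i j) 2 Γ.arcLength).toReal ≤
      ε * (1 * s + (eLpNorm (u i 0) 2 Γ.arcLength).toReal +
        (eLpNorm (u i 1) 2 Γ.arcLength).toReal) := by
    intro i j
    refine eLpNorm_two_toReal_le (huL i 0) (huL i 1) hε zero_le_one ?_
    filter_upwards [hDε, Γ.ae_mem_trace] with w hw hwt
    rw [hfu w hwt]
    calc _ ≤ ‖D i j w‖ + (‖u i 0 w‖ * ‖D 0 j w‖ + ‖u i 1 w‖ * ‖D 1 j w‖) := by
          refine (norm_add_le _ _).trans (add_le_add le_rfl ((norm_add_le _ _).trans ?_))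
          exact add_le_add (norm_mul_le _ _) (norm_mul_le _ _)
      _ ≤ ε + (‖u i 0 w‖ * ε + ‖u i 1 w‖ * ε) := by
          gcongr <;> exact hw _ _
      _ = _ := by ring
  -- With `S` the left side, adding the bounds for the two columns gives `S ≤ 2 Cb ε (s + S)`. As
  -- `Cb ε ≤ 1/4`, at most `S / 2` comes from the right-hand `S`; absorbing it, which is legitimate
  -- because `S` is finite, leaves `S ≤ 4 Cb ε s`.
  have hu : ∀ i, (eLpNorm (u i 0) 2 Γ.arcLength).toReal + (eLpNorm (u i 1) 2 Γ.arcLength).toReal ≤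
      4 * (Cb * ε) * s := by
    intro i
    have hCb0 : (0 : ℝ) ≤ Cb := Cb.2
    have h0 := (hCb i 0).trans (mul_le_mul_of_nonneg_left (hfn i 0) hCb0)
    have h1 := (hCb i 1).trans (mul_le_mul_of_nonneg_left (hfn i 1) hCb0)
    have hS0 : 0 ≤ (eLpNorm (u i 0) 2 Γ.arcLength).toReal +
      (eLpNorm (u i 1) 2 Γ.arcLength).toReal := by positivity
    nlinarith [mul_le_mul_of_nonneg_right hsmall hS0]
  have hE : ∀ i j, ‖Γ.cauchy (fun w => f i j w - D i j w) z‖ ≤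
      Cb * ε ^ 2 * Γ.length / Metric.infDist z Γ.trace := by
    intro i j
    have hEc : ContinuousOn (fun w => f i j w - D i j w) Γ.trace := (hfc i j).sub (hDc i j)
    have h2 : (eLpNorm (fun w => f i j w - D i j w) 2 Γ.arcLength).toReal ≤
        ε * (0 * s + (eLpNorm (u i 0) 2 Γ.arcLength).toReal +
        (eLpNorm (u i 1) 2 Γ.arcLength).toReal) := by
      refine eLpNorm_two_toReal_le (huL i 0) (huL i 1) hε le_rfl ?_
      filter_upwards [hDε, Γ.ae_mem_trace] with w hw hwt
      rw [hfu w hwt, add_sub_cancel_left]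
      calc _ ≤ ‖u i 0 w‖ * ‖D 0 j w‖ + ‖u i 1 w‖ * ‖D 1 j w‖ := by
            refine (norm_add_le _ _).trans ?_
            exact add_le_add (norm_mul_le _ _) (norm_mul_le _ _)
        _ ≤ ‖u i 0 w‖ * ε + ‖u i 1 w‖ * ε := by gcongr <;> exact hw _ _
        _ = _ := by ring
    -- Cauchy–Schwarz gives one factor `s` and `hu` another; `s * s` is the length.
    have h3 : (eLpNorm (fun w => f i j w - D i j w) 1 Γ.arcLength).toReal ≤
        4 * (Cb * ε ^ 2 * Γ.length) := by
      refine (eLpNorm_one_toReal_le (Γ.memLp_of_continuousOn hEc 2)).trans ?_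
      rw [zero_mul, zero_add] at h2
      calc _ ≤ s * (ε * (4 * (Cb * ε) * s)) :=
            mul_le_mul_of_nonneg_left (h2.trans (mul_le_mul_of_nonneg_left (hu i) hε)) hs0
        _ = 4 * (Cb * ε ^ 2 * (s * s)) := by ring
        _ = _ := by rw [hs2]
    have hl := Γ.length_nonneg
    have hπ := Real.pi_gt_three
    calc _ ≤ (2 * Real.pi * Metric.infDist z Γ.trace)⁻¹ * (4 * (Cb * ε ^ 2 * Γ.length)) :=
          (Γ.norm_cauchy_le hEc hz).trans (mul_le_mul_of_nonneg_left h3 (by positivity))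
      -- Here `4 ≤ 2π`, so the constant 4 of the `L¹` bound cancels.
      _ ≤ (4 * Metric.infDist z Γ.trace)⁻¹ * (4 * (Cb * ε ^ 2 * Γ.length)) := by
          gcongr
          linarith
      _ = _ := by
          field_simp
  refine (Matrix.norm_le_iff (by have := Γ.length_nonneg; positivity)).2 fun i j => ?_
  refine le_of_eq_of_le ?_ (hE i j)
  rw [Γ.cauchy_sub (hfc i j) (hDc i j) hz, ← Γ.cauchy_congr (fun w hw => hM w hw i j)]
  simp only [Xcont, Matrix.sub_apply, Matrix.add_apply, add_sub_add_left_eq_sub]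
  rfl

end SmallNorm

/-- From `|z| ≤ dist(z, Γ) + B`, where the constant `1 + B` is at most `(1 + B) / δ` times the
distance. -/
theorem one_add_norm_le_mul_infDist (Γ : Contour) {B δ : ℝ} (hB : ∀ w ∈ Γ.trace, ‖w‖ ≤ B)
    (hδ : 0 < δ) {z : ℂ} (hz : δ ≤ Metric.infDist z Γ.trace) :
    1 + ‖z‖ ≤ ((1 + B) / δ + 1) * Metric.infDist z Γ.trace := by
  obtain ⟨y, hy, hzy⟩ := Γ.isCompact_trace.exists_infDist_eq_dist Γ.nonempty_trace z
  have h1 := dist_triangle z y 0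
  simp only [dist_zero_right] at h1
  rw [← hzy] at h1
  have h2 := hB y hy
  have h3 : 0 ≤ 1 + B := by linarith [norm_nonneg y]
  have h4 : 1 + B ≤ (1 + B) / δ * Metric.infDist z Γ.trace := by
    calc 1 + B = (1 + B) / δ * δ := by field_simp
      _ ≤ _ := by gcongr
  linarith

end RHPerturb

end

theorem proposition2p1
    (Γ : ℕ → RHPerturb.Contour) (μ ν : ℕ → Measure ℝ) (n p : ℕ → ℕ) (𝔠 : ℕ → ℂ)
    (Cnorm : ℕ → NNReal) (L R : ℝ)
    (hμ : ∀ N, IsFiniteMeasure (μ N)) (hν : ∀ N, IsFiniteMeasure (ν N))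
    (hn : ∀ N, 1 ≤ n N)
    -- the orthogonal polynomials of degree `≤ n` exist and `‖π_{n-1}‖ ≠ 0`
    (hμn : ∀ N, (n N : ℕ∞) ≤ (μ N).support.encard)
    (hνn : ∀ N, (n N : ℕ∞) ≤ (ν N).support.encard)
    (h𝔠 : ∀ N, 𝔠 N ≠ 0)
    -- uniformity in `N`; the condition on `μ` is void if `μ` does not depend on `N`
    (hR : ∀ N, (μ N).support ⊆ Set.Icc (-R) R)
    (hL : ∀ N, (Γ N).length ≤ L)
    (hΓμ : ∀ N, (Γ N).Encircles (μ N)) (hΓν : ∀ N, (Γ N).Encircles (ν N))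
    (hC : ∀ N, (Γ N).ExteriorCauchyBound (Cnorm N))
    (hJ : Tendsto (fun N => (Cnorm N : ℝ) *
        (Γ N).linftyNorm (fun z => RHPerturb.Jmat (Γ N) (𝔠 N) (p N) (μ N) (ν N) (n N) z - 1))
      atTop (𝓝 0)) :
    -- `X N` is `X_n(·; μ, ν)`, continued analytically across the supports inside `Γ`
    ∃ X : ℕ → ℂ → Matrix (Fin 2) (Fin 2) ℂ,
      (∀ N i j, DifferentiableOn ℂ (fun z => X N z i j) (Γ N).traceᶜ) ∧
      (∀ N z, z ∉ (Γ N).trace → z ∉ Complex.ofReal '' ((μ N).support ∪ (ν N).support) →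
        X N z = RHPerturb.Xmat (Γ N) (𝔠 N) (p N) (μ N) (ν N) (n N) z) ∧
      ∀ δ : ℝ, 0 < δ → ∃ K : ℝ, ∀ᶠ N in atTop, ∀ z : ℂ, δ ≤ Metric.infDist z (Γ N).trace →
        ‖X N z - (1 + (Γ N).cauchyMatrix (fun w => RHPerturb.c0diff (μ N) (ν N) w •
            RHPerturb.Mmat (Γ N) (𝔠 N) (p N) (μ N) (n N) w) z)‖ ≤
          K * ((Cnorm N : ℝ) * (Γ N).linftyNorm (fun w =>
            RHPerturb.Jmat (Γ N) (𝔠 N) (p N) (μ N) (ν N) (n N) w - 1) ^ 2 / (1 + ‖z‖)) := by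
  have hμc := fun N => (Γ N).isCompact_support_of_encircles (hΓμ N)
  have hνc := fun N => (Γ N).isCompact_support_of_encircles (hΓν N)
  refine ⟨fun N => RHPerturb.Xcont (Γ N) (𝔠 N) (p N) (μ N) (ν N) (n N), fun N i j =>
    RHPerturb.differentiableOn_Xcont (Γ N) (hμc N) (hνc N) (hΓμ N) (hΓν N) (p N) i j,
    fun N z hz hzs => ?_, fun δ hδ => ?_⟩
  · rw [Set.image_union, Set.mem_union, not_or] at hzs
    exact RHPerturb.Xcont_eq_Xmat (Γ N) (hμc N) (hνc N) (hΓμ N) (hΓν N) (hμn N) (hνn N) (hn N)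
      (h𝔠 N) (p N) hz hzs.1 hzs.2
  -- The factor `L` bounds the length in the error estimate; the other factor converts the distance
  -- to `Γ` into `1 + ‖z‖` for a curve in the disc of radius `R + 2 * L`.
  · refine ⟨L * ((1 + (R + 2 * L)) / δ + 1), ?_⟩
    filter_upwards [hJ.eventually (ge_mem_nhds (show (0 : ℝ) < 1 / 4 by norm_num))] with N hN z hz
    have hd : 0 < Metric.infDist z (Γ N).trace := hδ.trans_le hz
    have hzt : z ∉ (Γ N).trace := ((Γ N).isCompact_trace.isClosed.notMem_iff_infDist_pos
      (Γ N).nonempty_trace).2 hd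
    refine (RHPerturb.norm_Xcont_sub_le (Γ N) (hΓμ N) (hΓν N) (hμn N) (hνn N) (hn N) (h𝔠 N) (p N)
      (hC N) hN hzt).trans ?_
    have hB : ∀ w ∈ (Γ N).trace, ‖w‖ ≤ R + 2 * L := by
      intro w hw
      -- As `n ≥ 1`, the support of `μ` has a point. It lies inside `Γ` and in `[-R, R]`, so it pins
      -- down the position of the curve.
      have hne : (μ N).support.Nonempty := by
        rw [Set.nonempty_iff_ne_empty]
        intro he
        have h := hμn N
        rw [he, Set.encard_empty, nonpos_iff_eq_zero, Nat.cast_eq_zero] at h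
        have := hn N
        omega
      obtain ⟨x, hx⟩ := hne
      have hxR : ‖(x : ℂ)‖ ≤ R := by
        rw [Complex.norm_real]
        exact abs_le.2 (hR N hx)
      linarith [(Γ N).norm_le_of_mem_trace (hΓμ N x hx) hxR hw, hL N]
    have hz1 := RHPerturb.one_add_norm_le_mul_infDist (Γ N) hB hδ hz
    have hl := (Γ N).length_nonneg
    generalize (Γ N).linftyNorm _ = ε
    rw [mul_div_assoc', div_le_div_iff₀ hd (by positivity)]
    have hA : 0 ≤ (Cnorm N : ℝ) * ε ^ 2 := by positivity
    calc (Cnorm N : ℝ) * ε ^ 2 * (Γ N).length * (1 + ‖z‖)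
        ≤ (Cnorm N : ℝ) * ε ^ 2 * L *
          (((1 + (R + 2 * L)) / δ + 1) * Metric.infDist z (Γ N).trace) := by
          refine mul_le_mul (mul_le_mul_of_nonneg_left (hL N) hA) hz1 (by positivity) ?_
          exact mul_nonneg hA (hl.trans (hL N))
      _ = _ := by ring
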